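/- Let $T>0$, let $\mathbb{R}^d$ carry the Euclidean norm $\|\cdot\|$, and let $1\le p<\infty$. For $f:[0,T]\to\mathbb{R}^d$ let $$V_p(f)=\sup_{0=t_0<t_1<\dots<t_n=T}\ \sum_{i=1}^n\frac{\|f(t_i)-f(t_{i-1})\|^p}{(t_i-t_{i-1})^{p-1}},$$ let $BV_p(\mathbb{R}^d)$ be the space of all $f$ with $V_p(f)<\infty$, normed by $\|f\|_{V_p}=\sup_{t\in[0,T]}\|f(t)\|+V_p(f)^{1/p}$, and let $f'$ denote the (almost everywhere existing) derivative of $f\in BV_p(\mathbb{R}^d)$. A set $\mathcal{R}\subset BV_p(\mathbb{R}^d)$ is called $V_p$-decomposable if for all $f_1,f_2\in\mathcal{R}$ and all $a\in[0,T]$ the function $$(f_1\oplus_a f_2)(t)=f_1(0)+\int_0^t\big(\mathbf 1_{[0,a)}(s)f_1'(s)+\mathbf 1_{[a,T]}(s)f_2'(s)\big)\,ds,\qquad t\in[0,T],$$ belongs to $\mathcal{R}$. Put $\mathcal{R}(t)=\{f(t):f\in\mathcal{R}\}$. Let $\mathrm{Comp}(\mathbb{R}^d)$ and $\mathrm{Conv}(\mathbb{R}^d)$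 be the families of nonempty compact, respectively nonempty compact convex, subsets of $\mathbb{R}^d$. For $A,B\in\mathrm{Conv}(\mathbb{R}^d)$ the Hukuhara difference $A\div B$ is the set $C\in\mathrm{Conv}(\mathbb{R}^d)$ with $A=B+C$, if it exists. A map $G$ with values in $\mathrm{Conv}(\mathbb{R}^d)$ is Hukuhara differentiable at $t_0\in(0,T)$ with derivative $D_HG(t_0)\in\mathrm{Conv}(\mathbb{R}^d)$ if, for all sufficiently small $h>0$, the differences $G(t_0+h)\div G(t_0)$ and $G(t_0)\div G(t_0-h)$ exist, and, divided by $h$, both converge to $D_HG(t_0)$ in the Hausdorff metric as $h\to0+$. Theorem. Let $\mathcal{R}\subset BV_p(\mathbb{R}^d)$ be closed and bounded with respect to $\|\cdot\|_{V_p}$ and $V_p$-decomposable, with $\mathcal{R}(0)=\{x_0\}$ for some $x_0\in\mathbb{R}^d$; if $p=1$, assume in addition that every $f\in\mathcal{R}$ is absolutely continuous. Then there is a set-valued function $\Phi:[0,T]\to\mathrm{Comp}(\mathbb{R}^d)$ that is measurable ($\{t:\Phi(t)\cap U\neq\emptyset\}$ is measurable for every open $U\subset\mathbb{R}^d$) and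 $p$-integrably bounded (there is $g\in L^p([0,T])$ with $\sup_{x\in\Phi(t)}\|x\|\le g(t)$ for almost every $t$), such that $\mathcal{R}(t)\in\mathrm{Conv}(\mathbb{R}^d)$ for every $t\in[0,T]$ and, for almost every $t\in[0,T]$, the set-valued function $t\mapsto\mathcal{R}(t)$ is Hukuhara differentiable at $t$ with $$D_H\mathcal{R}(t)=\overline{\mathrm{co}}\,\Phi(t).$$ -/

import Mathlib

open MeasureTheory Filter Topology
open scoped Pointwise ENNReal

noncomputable section

namespace RieszVar

/-- The Riesz `p`-variation `V_p(f,[0,T])`: the supremum over all partitions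
`0 = t_0 < t_1 < ... < t_n = T` of `∑ d(f(t_{i-1}), f(t_i))^p / (t_i - t_{i-1})^(p-1)`. -/
def rieszVariation {E : Type*} [PseudoMetricSpace E] {T : ℝ} (p : ℝ)
    (f : Set.Icc (0 : ℝ) T → E) : ℝ≥0∞ :=
  ⨆ (n : ℕ) (t : Fin (n + 1) → Set.Icc (0 : ℝ) T) (_ : StrictMono t)
    (_ : (t 0 : ℝ) = 0) (_ : (t (Fin.last n) : ℝ) = T),
    ∑ i : Fin n, ENNReal.ofReal
      (dist (f (t i.castSucc)) (f (t i.succ)) ^ p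
        / ((t i.succ : ℝ) - (t i.castSucc : ℝ)) ^ (p - 1))

/-- `BV_p(E)`: the functions `[0,T] → E` of finite Riesz `p`-variation. -/
def BV (E : Type*) [PseudoMetricSpace E] (T p : ℝ) : Set (Set.Icc (0 : ℝ) T → E) :=
  {f | rieszVariation p f < ⊤}

section Normed

variable {E : Type*} [NormedAddCommGroup E] {T : ℝ}

/-- The norm `sup_t ‖f(t)‖ + V_p(f)^(1/p)` of `BV_p(E)`, as an extended nonnegative number. -/
def vpNorm (p : ℝ) (f : Set.Icc (0 : ℝ) T → E) : ℝ≥0∞ :=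
  (⨆ t, ‖f t‖ₑ) + rieszVariation p f ^ (1 / p)

/-- `R` is bounded for the norm of `BV_p(E)`. -/
def IsVpBounded (p : ℝ) (R : Set (Set.Icc (0 : ℝ) T → E)) : Prop :=
  ∃ C : ℝ≥0∞, C < ⊤ ∧ ∀ f ∈ R, vpNorm p f ≤ C

/-- `R` is closed in `BV_p(E)` for the norm of that space. -/
def IsVpClosed (p : ℝ) (R : Set (Set.Icc (0 : ℝ) T → E)) : Prop :=
  ∀ f ∈ BV E T p, (∀ ε : ℝ≥0∞, 0 < ε → ∃ g ∈ R, vpNorm p (f - g) < ε) → f ∈ R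

variable [NormedSpace ℝ E]

/-- The derivative `f'` of a function on `[0,T]`. (The function is extended by constants outside
`[0,T]`; this affects nothing at points of the open interval.) -/
def derivIcc (hT : 0 ≤ T) (f : Set.Icc (0 : ℝ) T → E) : ℝ → E :=
  deriv (Set.IccExtend hT f)

/-- The function `f₁ ⊕_a f₂`,
`t ↦ f₁(0) + ∫_0^t (1_{[0,a)}(s) f₁'(s) + 1_{[a,T]}(s) f₂'(s)) ds`. -/
def oplus (hT : 0 ≤ T) (a : ℝ) (f₁ f₂ : Set.Icc (0 : ℝ) T → E) : Set.Icc (0 : ℝ) T → E :=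
  fun t => f₁ ⟨0, Set.left_mem_Icc.2 hT⟩ +
    ∫ s in (0 : ℝ)..(t : ℝ), ((Set.Ico 0 a).indicator (derivIcc hT f₁) s
      + (Set.Icc a T).indicator (derivIcc hT f₂) s)

/-- `V_p`-decomposability of a set of functions of `BV_p(E)`. -/
def IsVpDecomposable (hT : 0 ≤ T) (R : Set (Set.Icc (0 : ℝ) T → E)) : Prop :=
  ∀ f₁ ∈ R, ∀ f₂ ∈ R, ∀ a ∈ Set.Icc (0 : ℝ) T, oplus hT a f₁ f₂ ∈ R

end Normed

/-- The section `R(t) = {f(t) : f ∈ R}`. -/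
def valuesAt {E : Type*} {T : ℝ} (R : Set (Set.Icc (0 : ℝ) T → E)) (t : Set.Icc (0 : ℝ) T) :
    Set E :=
  (fun f => f t) '' R

section SetValued

variable {X : Type*} [NormedAddCommGroup X]

/-- Measurability of a compact-valued map: the preimage `{ω : Φ(ω) ∩ U ≠ ∅}` of every open set `U`
is measurable. -/
def IsMeasurableSetValued {Ω : Type*} [MeasurableSpace Ω]
    (Φ : Ω → TopologicalSpace.NonemptyCompacts X) : Prop :=
  ∀ U : Set X, IsOpen U → MeasurableSet {ω | ((Φ ω : Set X) ∩ U).Nonempty}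

/-- Lebesgue measure on `[0,T]`. -/
def lebesgue (T : ℝ) : Measure (Set.Icc (0 : ℝ) T) := (volume : Measure ℝ).comap Subtype.val

/-- `p`-integrable boundedness: `‖Φ(t)‖ = sup_{x ∈ Φ(t)} ‖x‖ ≤ g(t)` for a.e. `t`, for some `g` in
`L^p([0,T])`. -/
def IsIntegrablyBounded {T : ℝ} (p : ℝ)
    (Φ : Set.Icc (0 : ℝ) T → TopologicalSpace.NonemptyCompacts X) : Prop :=
  ∃ g : Set.Icc (0 : ℝ) T → ℝ, MemLp g (ENNReal.ofReal p) (lebesgue T) ∧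
    ∀ᵐ (t : Set.Icc (0 : ℝ) T) ∂(lebesgue T), ∀ x ∈ Φ t, ‖x‖ ≤ g t

variable [NormedSpace ℝ X]

/-- `C` is the Hukuhara difference `A ÷ B` of nonempty compact convex sets. -/
def IsHukuharaDifference (A B C : ConvexBody X) : Prop := A = B + C

/-- `D` is the Hukuhara derivative of `G` at `t₀`: the differences `G(t₀+h) ÷ G(t₀)` and
`G(t₀) ÷ G(t₀-h)` exist for all small `h > 0` and, divided by `h`, both tend to `D` in the
Hausdorff metric (the metric of `ConvexBody X`) as `h → 0+`. -/
def HasHukuharaDerivAt (G : ℝ → ConvexBody X) (t₀ : ℝ) (D : ConvexBody X) : Prop :=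
  (∃ C : ℝ → ConvexBody X,
    (∀ᶠ h in 𝓝[>] (0 : ℝ), IsHukuharaDifference (G (t₀ + h)) (G t₀) (C h)) ∧
      Tendsto (fun h : ℝ => h⁻¹ • C h) (𝓝[>] 0) (𝓝 D)) ∧
  (∃ C : ℝ → ConvexBody X,
    (∀ᶠ h in 𝓝[>] (0 : ℝ), IsHukuharaDifference (G t₀) (G (t₀ - h)) (C h)) ∧
      Tendsto (fun h : ℝ => h⁻¹ • C h) (𝓝[>] 0) (𝓝 D))

end SetValued

end RieszVar

end

/-! Every member of `R` is absolutely continuous: this is assumed for `p = 1`, and for `p > 1` it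
follows from finite Riesz variation. Hence `f = x₀ + ∫ f'`, and `R` corresponds to the set `K` of
its densities. Riesz's inequalities between `V_p(f)` and `∫ ‖f'‖^p`, in both directions, turn
closedness and boundedness of `R` into closedness and boundedness of `K` in `L^p`. Decomposability
of `R` says that `K` is stable under splicing along half-lines, and closedness upgrades this to all
measurable sets.

Choose a sequence `f n` in `K` that is dense in `L^p`, and let `Φ(s)` be the closure of `{f n s}`.
Splicing puts finite pointwise maximisers back into `K`, so `g = sup ‖f n‖` is in `L^p` and
dominates all of `K`.

For measurable `A`, the set `∫_A K` is convex by Lyapunov's theorem. It is also compact: the extreme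
points of its closure are attained, and Minkowski's theorem recovers the closure as their convex
hull. Splicing gives `∫_{A ∪ B} K = ∫_A K + ∫_B K` for disjoint `A`, `B`, so the Hukuhara
differences of `R(t) = x₀ + ∫_{(0,t]} K` are the integral sets over short intervals.

The support function of `∫_A K` is the integral over `A` of the support function of `Φ(s)`. Lebesgue
differentiation in countably many directions, with a uniform bound from `g`, then gives Hausdorff
convergence of the difference quotients to the closed convex hull of `Φ(t)`. -/

/-! ### Lyapunov's convexity theorem, through extreme points of a weak-* compact set. -/

section Lyapunov

variable {α : Type*} [MeasurableSpace α] {ν : Measure α}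

theorem L2_inner_nonneg {f g : Lp ℝ 2 ν} (hf : 0 ≤ᵐ[ν] f) (hg : 0 ≤ᵐ[ν] g) :
    0 ≤ inner ℝ f g := by
  rw [L2.inner_def]
  refine integral_nonneg_of_ae ?_
  filter_upwards [hf, hg] with x h1 h2
  simp only [Pi.zero_apply] at h1 h2 ⊢
  simpa using mul_nonneg h2 h1

/-- The functionals on `L²` that are represented by functions with values in `[0,1]` and that
take the values `b i` at `w i`. -/
def unitFunctionals (ν : Measure α) [IsFiniteMeasure ν] {ι : Type*} (w : ι → Lp ℝ 2 ν)
    (b : ι → ℝ) : Set (WeakDual ℝ (Lp ℝ 2 ν)) :=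
  {φ | (∀ f : Lp ℝ 2 ν, 0 ≤ᵐ[ν] f → 0 ≤ φ f ∧
      φ f ≤ inner ℝ (indicatorConstLp 2 MeasurableSet.univ (measure_ne_top ν _) (1 : ℝ)) f) ∧
    ∀ i, φ (w i) = b i}

/-- Banach–Alaoglu: the conditions are weak-* closed, and `φ f ≤ φ |f| ≤ ⟪1, |f|⟫ ≤ ‖1‖ ‖f‖` places
the set in a dual ball. -/
theorem isCompact_unitFunctionals [IsFiniteMeasure ν] {ι : Type*} (w : ι → Lp ℝ 2 ν)
    (b : ι → ℝ) : IsCompact (unitFunctionals ν w b) := by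
  set one : Lp ℝ 2 ν := indicatorConstLp 2 MeasurableSet.univ (measure_ne_top ν _) (1 : ℝ)
  refine (WeakDual.isCompact_closedBall (𝕜 := ℝ) (0 : StrongDual ℝ (Lp ℝ 2 ν)) ‖one‖).of_isClosed_subset
    ?_ ?_
  · have : unitFunctionals ν w b =
        (⋂ f : Lp ℝ 2 ν, ⋂ _ : 0 ≤ᵐ[ν] f, {φ : WeakDual ℝ (Lp ℝ 2 ν) | 0 ≤ φ f} ∩
          {φ | φ f ≤ inner ℝ one f}) ∩ ⋂ i, {φ | φ (w i) = b i} := by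
      ext φ
      simp [unitFunctionals, one]
    rw [this]
    refine IsClosed.inter (isClosed_iInter fun f => isClosed_iInter fun _ => IsClosed.inter ?_ ?_)
      (isClosed_iInter fun i => ?_)
    · exact isClosed_le continuous_const (WeakDual.eval_continuous f)
    · exact isClosed_le (WeakDual.eval_continuous f) continuous_const
    · exact isClosed_eq (WeakDual.eval_continuous _) continuous_const
  · intro φ hφ
    simp only [Set.mem_preimage, mem_closedBall_zero_iff]
    refine ContinuousLinearMap.opNorm_le_bound _ (norm_nonneg _) fun f => ?_
    have key : ∀ f : Lp ℝ 2 ν, φ f ≤ ‖one‖ * ‖f‖ := by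
      intro f
      have h1 := (hφ.1 (|f| - f) (by
        filter_upwards [Lp.coeFn_sub |f| f, Lp.coeFn_abs f] with x h1 h2
        rw [h1, Pi.sub_apply, h2]
        simp [le_abs_self])).1
      have h2 := (hφ.1 |f| (by
        filter_upwards [Lp.coeFn_abs f] with x h2
        rw [h2]
        simp)).2
      have h3 := real_inner_le_norm one |f|
      rw [norm_abs_eq_norm] at h3
      have h4 : φ (|f| - f) = φ |f| - φ f := map_sub φ _ _
      linarith
    rw [Real.norm_eq_abs, abs_le]
    have h1 := key f
    have h2 := key (-f)
    rw [norm_neg] at h2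
    have h3 : φ (-f) = - φ f := map_neg φ _
    constructor
    · change _ ≤ φ f
      linarith
    · exact h1

theorem coeFn_one [IsFiniteMeasure ν] :
    (indicatorConstLp 2 MeasurableSet.univ (measure_ne_top ν _) (1 : ℝ) : α → ℝ) =ᵐ[ν] 1 := by
  filter_upwards [indicatorConstLp_coeFn (p := 2) (hs := MeasurableSet.univ)
    (hμs := measure_ne_top ν _) (c := (1 : ℝ))] with x hx
  rw [hx]
  simp

theorem mem_unitFunctionals_iff [IsFiniteMeasure ν] {ι : Type*} (w : ι → Lp ℝ 2 ν)
    (b : ι → ℝ) (h : Lp ℝ 2 ν) :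
    (InnerProductSpace.toDual ℝ (Lp ℝ 2 ν) h : WeakDual ℝ (Lp ℝ 2 ν)) ∈ unitFunctionals ν w b ↔
      (∀ᵐ x ∂ν, 0 ≤ h x ∧ h x ≤ 1) ∧ ∀ i, inner ℝ h (w i) = b i := by
  have hint : Integrable h ν := (Lp.memLp h).integrable (by norm_num)
  unfold unitFunctionals
  refine and_congr ⟨fun H => ?_, fun H f hf => ?_⟩ Iff.rfl
  · have h1 : 0 ≤ᵐ[ν] h := by
      refine ae_nonneg_of_forall_setIntegral_nonneg hint fun s hs hs' => ?_
      have := (H (indicatorConstLp 2 hs hs'.ne (1 : ℝ)) (by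
        filter_upwards [indicatorConstLp_coeFn (p := 2) (hs := hs) (hμs := hs'.ne)
          (c := (1 : ℝ))] with x hx
        rw [hx]
        exact Set.indicator_nonneg (fun _ _ => zero_le_one) x)).1
      change 0 ≤ inner ℝ h _ at this
      rwa [real_inner_comm, L2.inner_indicatorConstLp_one] at this
    have h2 : h ≤ᵐ[ν] fun _ => (1 : ℝ) := by
      refine ae_le_of_forall_setIntegral_le hint (integrable_const _) fun s hs hs' => ?_
      have := (H (indicatorConstLp 2 hs hs'.ne (1 : ℝ)) (by
        filter_upwards [indicatorConstLp_coeFn (p := 2) (hs := hs) (hμs := hs'.ne)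
          (c := (1 : ℝ))] with x hx
        rw [hx]
        exact Set.indicator_nonneg (fun _ _ => zero_le_one) x)).2
      change inner ℝ h _ ≤ inner ℝ _ _ at this
      rw [real_inner_comm, L2.inner_indicatorConstLp_one, real_inner_comm,
        L2.inner_indicatorConstLp_one] at this
      refine this.trans (le_of_eq (integral_congr_ae ?_))
      exact ae_restrict_of_ae coeFn_one
    filter_upwards [h1, h2] with x h1 h2 using ⟨h1, h2⟩
  · change 0 ≤ inner ℝ h f ∧ inner ℝ h f ≤ inner ℝ _ f
    refine ⟨L2_inner_nonneg (H.mono fun x hx => hx.1) hf, ?_⟩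
    rw [← sub_nonneg, ← inner_sub_left]
    refine L2_inner_nonneg ?_ hf
    filter_upwards [H, Lp.coeFn_sub (indicatorConstLp 2 MeasurableSet.univ
      (measure_ne_top ν _) (1 : ℝ)) h, coeFn_one (ν := ν)] with x h1 h2 h3
    rw [h2, Pi.sub_apply, h3]
    simpa using h1.2

/-- Dimension count: polynomials of degree at most `card ι` form a space of dimension `card ι + 1`,
too large to inject into `ι → ℝ`. Composing with `arctan` keeps the functions bounded on the line
and, by injectivity, leaves them only finitely many zeros. -/
theorem exists_polynomial_setIntegral_eq_zero {ν : Measure ℝ} [IsFiniteMeasure ν]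
    {ι : Type*} [Fintype ι] {w : ι → ℝ → ℝ} (hw : ∀ i, Integrable (w i) ν) (A : Set ℝ) :
    ∃ q : Polynomial ℝ, q ≠ 0 ∧ ∀ i, ∫ s in A, q.eval (Real.arctan s) * w i s ∂ν = 0 := by
  have hb : ∀ (q : Polynomial ℝ), ∃ C, ∀ s, ‖q.eval (Real.arctan s)‖ ≤ C := by
    intro q
    obtain ⟨C, hC⟩ := (isCompact_Icc (a := -(Real.pi / 2)) (b := Real.pi / 2)).exists_bound_of_continuousOn
      (q.continuous.continuousOn)
    exact ⟨C, fun s => hC _ ⟨(Real.neg_pi_div_two_lt_arctan s).le, (Real.arctan_lt_pi_div_two s).le⟩⟩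
  have hint : ∀ (q : Polynomial ℝ) i, Integrable (fun s => q.eval (Real.arctan s) * w i s)
      (ν.restrict A) := by
    intro q i
    obtain ⟨C, hC⟩ := hb q
    refine (hw i).restrict.bdd_mul (c := C) ?_ (ae_of_all _ hC)
    exact (q.continuous.comp Real.continuous_arctan).aestronglyMeasurable
  let n := Fintype.card ι + 1
  let L : Polynomial.degreeLT ℝ n →ₗ[ℝ] (ι → ℝ) :=
    { toFun := fun q i => ∫ s in A, (q : Polynomial ℝ).eval (Real.arctan s) * w i s ∂ν
      map_add' := by
        intro q r
        ext i
        simp only [Submodule.coe_add, Polynomial.eval_add, add_mul, Pi.add_apply]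
        exact integral_add (hint _ i) (hint _ i)
      map_smul' := by
        intro c q
        ext i
        simp only [Submodule.coe_smul, Polynomial.eval_smul, smul_eq_mul, mul_assoc, RingHom.id_apply,
          Pi.smul_apply]
        exact integral_const_mul _ _ }
  have hdim : Module.finrank ℝ (ι → ℝ) < Module.finrank ℝ (Polynomial.degreeLT ℝ n) := by
    rw [LinearEquiv.finrank_eq (Polynomial.degreeLTEquiv ℝ n)]
    simp [n]
  have : FiniteDimensional ℝ (Polynomial.degreeLT ℝ n) :=
    LinearEquiv.finiteDimensional (Polynomial.degreeLTEquiv ℝ n).symm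
  obtain ⟨q, hq, hq0⟩ := Submodule.exists_mem_ne_zero_of_ne_bot
    (LinearMap.ker_ne_bot_of_finrank_lt (f := L) hdim)
  refine ⟨q, fun h => hq0 (Subtype.ext h), fun i => ?_⟩
  exact congrFun (LinearMap.mem_ker.1 hq) i


/-- Where `ε ≤ h ≤ 1 - ε` there is room to perturb: a small multiple `G` of the polynomial above,
cut off to that set, is orthogonal to every `w i`, so `h + G` and `h - G` both stay admissible.
Extremality forces `G = 0`. The polynomial factor vanishes only on a finite set, which is null
without atoms, so the set where `ε ≤ h ≤ 1 - ε` is null. -/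
theorem ae_eq_zero_or_one_of_mem_extremePoints {ν : Measure ℝ} [IsFiniteMeasure ν]
    [NullSingletonClass ν] {ι : Type*} [Fintype ι] {w : ι → Lp ℝ 2 ν} {b : ι → ℝ} {h : Lp ℝ 2 ν}
    (hh : (InnerProductSpace.toDual ℝ (Lp ℝ 2 ν) h : WeakDual ℝ (Lp ℝ 2 ν)) ∈
      Set.extremePoints ℝ (unitFunctionals ν w b)) :
    ∀ᵐ x ∂ν, h x = 0 ∨ h x = 1 := by
  obtain ⟨hmem, hext⟩ := mem_extremePoints.1 hh
  obtain ⟨h01, hwb⟩ := (mem_unitFunctionals_iff w b h).1 hmem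
  have hmeas : Measurable h := (Lp.stronglyMeasurable h).measurable
  have key : ∀ n : ℕ, ∀ᵐ x ∂ν, ¬ (1 / ((n : ℝ) + 1) ≤ h x ∧ h x ≤ 1 - 1 / ((n : ℝ) + 1)) := by
    intro n
    set ε : ℝ := 1 / ((n : ℝ) + 1) with hε
    have hε0 : 0 < ε := by positivity
    let A : Set ℝ := {x | ε ≤ h x ∧ h x ≤ 1 - ε}
    have hA : MeasurableSet A :=
      (measurableSet_le measurable_const hmeas).inter (measurableSet_le hmeas measurable_const)
    obtain ⟨q, hq0, hq⟩ := exists_polynomial_setIntegral_eq_zero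
      (w := fun i => (w i : ℝ → ℝ)) (fun i => (Lp.memLp (w i)).integrable (by norm_num)) A
    obtain ⟨C, hC⟩ := (isCompact_Icc (a := -(Real.pi / 2)) (b := Real.pi / 2)).exists_bound_of_continuousOn
      (q.continuous.continuousOn)
    have hC' : ∀ s, ‖q.eval (Real.arctan s)‖ ≤ C := fun s =>
      hC _ ⟨(Real.neg_pi_div_two_lt_arctan s).le, (Real.arctan_lt_pi_div_two s).le⟩
    have hC0 : 0 ≤ C := (norm_nonneg _).trans (hC' 0)
    let g : ℝ → ℝ := A.indicator fun s => ε / (C + 1) * q.eval (Real.arctan s)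
    have hgε : ∀ s, |g s| ≤ A.indicator (fun _ => ε) s := by
      intro s
      by_cases hs : s ∈ A
      · simp only [g, Set.indicator_of_mem hs, abs_mul]
        have h1 := hC' s
        rw [Real.norm_eq_abs] at h1
        rw [abs_of_pos (by positivity : 0 < ε / (C + 1)), div_mul_eq_mul_div,
          div_le_iff₀ (by positivity)]
        gcongr
        linarith
      · simp [g, Set.indicator_of_notMem hs]
    have hgm : MemLp g 2 ν := by
      refine MemLp.of_bound (C := ε) ?_ (ae_of_all _ fun s => ?_)
      · exact ((measurable_const.mul (q.continuous.comp Real.continuous_arctan).measurable).indicator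
          hA).aestronglyMeasurable
      · rw [Real.norm_eq_abs]
        refine (hgε s).trans ?_
        by_cases hs : s ∈ A <;> simp [hs, hε0.le]
    set G : Lp ℝ 2 ν := hgm.toLp g
    have hGg : G =ᵐ[ν] g := hgm.coeFn_toLp
    have hGw : ∀ i, inner ℝ G (w i) = 0 := by
      intro i
      rw [L2.inner_def]
      have : ∫ a, inner ℝ (G a) (w i a) ∂ν =
          ∫ a, A.indicator (fun s => ε / (C + 1) * (q.eval (Real.arctan s) * w i s)) a ∂ν := by
        refine integral_congr_ae ?_
        filter_upwards [hGg] with x hx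
        rw [hx]
        by_cases hs : x ∈ A <;> simp [g, hs]
        ring
      rw [this, integral_indicator hA, integral_const_mul, hq i, mul_zero]
    have hmem' : ∀ H : Lp ℝ 2 ν, (∀ᵐ x ∂ν, H x = h x + g x ∨ H x = h x - g x) →
        (∀ i, inner ℝ H (w i) = b i) →
        (InnerProductSpace.toDual ℝ (Lp ℝ 2 ν) H : WeakDual ℝ (Lp ℝ 2 ν)) ∈
          unitFunctionals ν w b := by
      intro H hH hHw
      refine (mem_unitFunctionals_iff w b H).2 ⟨?_, hHw⟩
      filter_upwards [hH, h01] with x hx hx1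
      have h2 := abs_le.1 (hgε x)
      by_cases hs : x ∈ A
      · rw [Set.indicator_of_mem hs] at h2
        have h3 : ε ≤ h x ∧ h x ≤ 1 - ε := hs
        rcases hx with hx | hx <;> rw [hx] <;> constructor <;> linarith
      · rw [Set.indicator_of_notMem hs] at h2
        rcases hx with hx | hx <;> rw [hx] <;> constructor <;> linarith
    have hplus := hmem' (h + G) (by
      filter_upwards [Lp.coeFn_add h G, hGg] with x h1 h2
      left
      rw [h1, Pi.add_apply, h2]) (fun i => by rw [inner_add_left, hGw, hwb, add_zero])
    have hminus := hmem' (h - G) (by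
      filter_upwards [Lp.coeFn_sub h G, hGg] with x h1 h2
      right
      rw [h1, Pi.sub_apply, h2]) (fun i => by rw [inner_sub_left, hGw, hwb, sub_zero])
    have heq := (hext _ hplus _ hminus (by
      refine ⟨1 / 2, 1 / 2, by norm_num, by norm_num, by norm_num, ?_⟩
      refine ContinuousLinearMap.ext fun f => ?_
      change (1 / 2 : ℝ) * inner ℝ (h + G) f + (1 / 2 : ℝ) * inner ℝ (h - G) f = inner ℝ h f
      rw [inner_add_left, inner_sub_left]
      ring)).1
    have hG0 : G = 0 := by
      have h1 : h + G = h := (InnerProductSpace.toDual ℝ (Lp ℝ 2 ν)).injective heq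
      simpa using h1
    have hroot : ∀ᵐ s ∂ν, q.eval (Real.arctan s) ≠ 0 := by
      have hfin : {s | q.eval (Real.arctan s) = 0}.Finite :=
        (Polynomial.finite_setOfPred_isRoot hq0).preimage (Real.arctan_injective.injOn)
      rw [ae_iff]
      simpa using hfin.measure_zero ν
    filter_upwards [hGg, hroot, (Lp.coeFn_zero ℝ 2 ν)] with s h1 h2 h3
    intro hs
    rw [hG0, h3] at h1
    have hs' : s ∈ A := hs
    simp only [g, Set.indicator_of_mem hs', Pi.zero_apply] at h1
    rcases mul_eq_zero.1 h1.symm with h4 | h4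
    · exact (by positivity : 0 < ε / (C + 1)).ne' h4
    · exact h2 h4
  filter_upwards [ae_all_iff.2 key, h01] with x hx hx1
  by_contra! hne
  have h0 : 0 < h x := lt_of_le_of_ne hx1.1 hne.1.symm
  have h1 : 0 < 1 - h x := sub_pos.2 (lt_of_le_of_ne hx1.2 hne.2)
  obtain ⟨n, hn⟩ := exists_nat_one_div_lt (lt_min h0 h1)
  have h2 := hn.trans_le (min_le_left _ _)
  have h3 := hn.trans_le (min_le_right _ _)
  exact hx n ⟨h2.le, by linarith⟩

/-- The constant `c` is admissible, so the compact set of admissible functionals has an extreme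
point. This is the indicator of the required set `B`. -/
theorem exists_setIntegral_eq_mul_of_memLp_two {ν : Measure ℝ} [IsFiniteMeasure ν]
    [NullSingletonClass ν] {ι : Type*} [Fintype ι] {w : ι → ℝ → ℝ} (hw : ∀ i, MemLp (w i) 2 ν)
    {c : ℝ} (hc0 : 0 ≤ c) (hc1 : c ≤ 1) :
    ∃ B : Set ℝ, MeasurableSet B ∧ ∀ i, ∫ s in B, w i s ∂ν = c * ∫ s, w i s ∂ν := by
  let W : ι → Lp ℝ 2 ν := fun i => (hw i).toLp (w i)
  let b : ι → ℝ := fun i => c * ∫ s, w i s ∂ν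
  set one : Lp ℝ 2 ν := indicatorConstLp 2 MeasurableSet.univ (measure_ne_top ν _) (1 : ℝ)
  have hne : (unitFunctionals ν W b).Nonempty := by
    refine ⟨InnerProductSpace.toDual ℝ (Lp ℝ 2 ν) (c • one),
      (mem_unitFunctionals_iff W b _).2 ⟨?_, fun i => ?_⟩⟩
    · filter_upwards [Lp.coeFn_smul c one, coeFn_one (ν := ν)] with x h1 h2
      rw [h1, Pi.smul_apply, h2]
      simp [hc0, hc1]
    · rw [real_inner_smul_left, L2.inner_indicatorConstLp_one, Measure.restrict_univ,
        integral_congr_ae (hw i).coeFn_toLp]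
  have : LocallyConvexSpace ℝ (WeakDual ℝ (Lp ℝ 2 ν)) :=
    inferInstanceAs (LocallyConvexSpace ℝ (WeakBilin (topDualPairing ℝ (Lp ℝ 2 ν))))
  obtain ⟨φ, hφ⟩ := (isCompact_unitFunctionals W b).extremePoints_nonempty hne
  obtain ⟨h, rfl⟩ := (InnerProductSpace.toDual ℝ (Lp ℝ 2 ν)).surjective φ
  have hmeas : Measurable h := (Lp.stronglyMeasurable h).measurable
  have hB : MeasurableSet {x | h x = 1} := hmeas (measurableSet_singleton 1)
  refine ⟨{x | h x = 1}, hB, fun i => ?_⟩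
  have h1 := ((mem_unitFunctionals_iff W b h).1 hφ.1).2 i
  rw [L2.inner_def] at h1
  rw [← integral_indicator hB]
  refine Eq.trans (integral_congr_ae ?_) h1
  filter_upwards [ae_eq_zero_or_one_of_mem_extremePoints hφ, (hw i).coeFn_toLp] with x hx hwx
  simp only [W, hwx]
  rcases hx with hx | hx <;> simp [Set.indicator, hx]

/-- **Lyapunov's convexity theorem**: the values of a vector measure with an integrable density
with respect to a finite atomless measure on the line contain the segment from `0` to the total
value. -/
theorem exists_setIntegral_eq_mul {μ : Measure ℝ} [IsFiniteMeasure μ]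
    [NullSingletonClass μ] {ι : Type*} [Fintype ι] {v : ι → ℝ → ℝ} (hv : ∀ i, Integrable (v i) μ)
    {c : ℝ} (hc0 : 0 ≤ c) (hc1 : c ≤ 1) :
    ∃ B : Set ℝ, MeasurableSet B ∧ ∀ i, ∫ s in B, v i s ∂μ = c * ∫ s, v i s ∂μ := by
  let v' : ι → ℝ → ℝ := fun i => (hv i).1.mk (v i)
  have hvm : ∀ i, Measurable (v' i) := fun i => (hv i).1.stronglyMeasurable_mk.measurable
  have hvv : ∀ i, v i =ᵐ[μ] v' i := fun i => (hv i).1.ae_eq_mk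
  have hv' : ∀ i, Integrable (v' i) μ := fun i => (hv i).congr (hvv i)
  -- Moving the weight `ρ` from the densities into the measure leaves the integrals unchanged and
  -- makes each `v i / ρ` bounded by `1`, hence square integrable.
  let ρ : ℝ → NNReal := fun s => 1 + ∑ i, ‖v' i s‖₊
  have hρ : Measurable ρ := measurable_const.add
    (Finset.measurable_sum _ fun i _ => (hvm i).nnnorm)
  let ν := μ.withDensity fun s => (ρ s : ℝ≥0∞)
  have hνμ : ν ≪ μ := withDensity_absolutelyContinuous _ _
  have hfin : IsFiniteMeasure ν := by
    refine isFiniteMeasure_withDensity ?_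
    simp only [ρ, ENNReal.coe_add, ENNReal.coe_one, ENNReal.ofNNReal_finsetSum]
    rw [lintegral_add_left measurable_const, lintegral_finsetSum _ fun i _ => by
      exact (hvm i).nnnorm.coe_nnreal_ennreal]
    refine ENNReal.add_ne_top.2 ⟨by simp, ?_⟩
    exact ENNReal.sum_ne_top.2 fun i _ => (hv' i).2.ne
  have hat : NullSingletonClass ν := ⟨fun x => hνμ (measure_singleton x)⟩
  let w : ι → ℝ → ℝ := fun i s => (ρ s : ℝ)⁻¹ * v' i s
  have hρ1 : ∀ s, (1 : ℝ) ≤ ρ s := by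
    intro s
    simp only [ρ, NNReal.coe_add, NNReal.coe_one, NNReal.coe_sum, coe_nnnorm]
    exact le_add_of_nonneg_right (Finset.sum_nonneg fun _ _ => norm_nonneg _)
  have hw : ∀ i, MemLp (w i) 2 ν := by
    intro i
    refine MemLp.of_bound (C := 1) ?_ (ae_of_all _ fun s => ?_)
    · exact (hρ.coe_nnreal_real.inv.mul (hvm i)).aestronglyMeasurable
    · have h0 : (0 : ℝ) < ρ s := zero_lt_one.trans_le (hρ1 s)
      simp only [w, norm_mul, norm_inv]
      rw [Real.norm_of_nonneg h0.le, inv_mul_le_iff₀ h0, mul_one]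
      simp only [ρ, NNReal.coe_add, NNReal.coe_one, NNReal.coe_sum, coe_nnnorm]
      have := Finset.single_le_sum (f := fun i => ‖v' i s‖) (fun _ _ => norm_nonneg _)
        (Finset.mem_univ i)
      linarith
  have hconv : ∀ (B : Set ℝ), MeasurableSet B → ∀ i, ∫ s in B, w i s ∂ν = ∫ s in B, v i s ∂μ := by
    intro B hB i
    have h1 : ν.restrict B = (μ.restrict B).withDensity fun s => (ρ s : ℝ≥0∞) :=
      restrict_withDensity hB _
    rw [h1, integral_withDensity_eq_integral_smul hρ]
    refine integral_congr_ae ?_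
    filter_upwards [ae_restrict_of_ae (hvv i)] with s hs
    have h0 : (0 : ℝ) < ρ s := zero_lt_one.trans_le (hρ1 s)
    rw [hs, NNReal.smul_def, smul_eq_mul, mul_inv_cancel_left₀ h0.ne']
  obtain ⟨B, hB, hBw⟩ := exists_setIntegral_eq_mul_of_memLp_two hw hc0 hc1
  refine ⟨B, hB, fun i => ?_⟩
  have h2 := hconv Set.univ MeasurableSet.univ i
  simp only [Measure.restrict_univ] at h2
  rw [← hconv B hB i, hBw i, h2]

theorem exists_setIntegral_eq_smul {μ : Measure ℝ} [IsFiniteMeasure μ] [NullSingletonClass μ]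
    {d : ℕ} {v : ℝ → EuclideanSpace ℝ (Fin d)} (hv : Integrable v μ) {c : ℝ} (hc0 : 0 ≤ c)
    (hc1 : c ≤ 1) :
    ∃ B : Set ℝ, MeasurableSet B ∧ ∫ s in B, v s ∂μ = c • ∫ s, v s ∂μ := by
  have hcoord : ∀ (κ : Measure ℝ), Integrable v κ → ∀ i, (∫ s, v s ∂κ) i = ∫ s, v s i ∂κ := by
    intro κ hκ i
    exact ((EuclideanSpace.proj i : EuclideanSpace ℝ (Fin d) →L[ℝ] ℝ).integral_comp_comm hκ).symm
  obtain ⟨B, hB, h⟩ := exists_setIntegral_eq_mul (v := fun (i : Fin d) s => v s i)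
    (fun i => (EuclideanSpace.proj i : EuclideanSpace ℝ (Fin d) →L[ℝ] ℝ).integrable_comp hv) hc0 hc1
  refine ⟨B, hB, ?_⟩
  ext i
  rw [hcoord _ hv.restrict, PiLp.smul_apply, hcoord _ hv, h i, smul_eq_mul]

end Lyapunov

/-! ### Minkowski's theorem and the strength of extreme points in compact sets. -/

section Minkowski

/-- The induction step on dimension: the face through `z` is carried into `W` by translation, and
extreme points of a face are extreme in `C`. -/
theorem mem_convexHull_extremePoints_of_isExtreme_inter {E : Type*} [NormedAddCommGroup E]
    [NormedSpace ℝ E] [FiniteDimensional ℝ E] {C : Set E} (hC : IsCompact C) (hconv : Convex ℝ C)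
    {z : E} (hz : z ∈ C) (W : Submodule ℝ E)
    (hface : IsExtreme ℝ C (C ∩ {x | x - z ∈ W}))
    (ih : ∀ D : Set W, IsCompact D → Convex ℝ D → D ⊆ convexHull ℝ (D.extremePoints ℝ)) :
    z ∈ convexHull ℝ (C.extremePoints ℝ) := by
  let j : W →ᵃ[ℝ] E := W.subtype.toAffineMap + AffineMap.const ℝ W z
  have hj : ∀ w : W, j w = w + z := fun w => rfl
  have hemb : IsClosedEmbedding j := by
    have : (j : W → E) = (Homeomorph.addRight z) ∘ (Subtype.val : W → E) := funext hj
    rw [this]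
    exact (Homeomorph.addRight z).isClosedEmbedding.comp
      (W.closed_of_finiteDimensional.isClosedEmbedding_subtypeVal)
  have hD : IsCompact (j ⁻¹' C) := hemb.isCompact_preimage hC
  have h0 : (0 : W) ∈ j ⁻¹' C := by
    simp only [Set.mem_preimage, hj]
    simpa using hz
  have h1 := ih _ hD (hconv.affine_preimage j) h0
  have h2 : z ∈ j '' convexHull ℝ ((j ⁻¹' C).extremePoints ℝ) := ⟨0, h1, by simp [hj]⟩
  rw [AffineMap.image_convexHull] at h2
  refine convexHull_mono ?_ h2
  rintro _ ⟨e, he, rfl⟩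
  rw [mem_extremePoints] at he ⊢
  have hjF : ∀ w : W, j w ∈ {x | x - z ∈ W} := fun w => by simp [hj]
  refine ⟨he.1, fun x₁ hx₁ x₂ hx₂ hs => ?_⟩
  have hm : j e ∈ C ∩ {x | x - z ∈ W} := ⟨he.1, hjF e⟩
  have a1 := hface.left_mem_of_mem_openSegment hx₁ hx₂ hm hs
  have a2 := hface.right_mem_of_mem_openSegment hx₁ hx₂ hm hs
  obtain ⟨w₁, rfl⟩ : ∃ w : W, j w = x₁ := ⟨⟨x₁ - z, a1.2⟩, by simp [hj]⟩
  obtain ⟨w₂, rfl⟩ : ∃ w : W, j w = x₂ := ⟨⟨x₂ - z, a2.2⟩, by simp [hj]⟩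
  have hs' : e ∈ openSegment ℝ w₁ w₂ := by
    rw [← image_openSegment] at hs
    obtain ⟨w, hw, hwe⟩ := hs
    rwa [← hemb.injective hwe]
  obtain ⟨b1, b2⟩ := he.2 w₁ hx₁ w₂ hx₂ hs'
  rw [b1, b2]
  exact ⟨rfl, rfl⟩

/-- Let `S` be the convex hull of the extreme points; by Krein–Milman its closure is `C`. If a point
`z` of `C` were outside `S`, there are two cases. If `S` has interior, a functional separating `z`
from it attains its minimum over `C` at `z`, so its level set cuts out a face of lower dimension.
Otherwise `C` lies in a proper affine subspace. Induction applies in both cases. -/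
theorem subset_convexHull_extremePoints_of_finrank.{u} (n : ℕ) :
    ∀ (E : Type u) [NormedAddCommGroup E] [NormedSpace ℝ E] [FiniteDimensional ℝ E],
      Module.finrank ℝ E = n → ∀ C : Set E, IsCompact C → Convex ℝ C →
        C ⊆ convexHull ℝ (C.extremePoints ℝ) := by
  induction n using Nat.strong_induction_on with
  | _ n ih =>
  intro E _ _ _ hn C hC hconv z hz
  by_contra hzS
  have hcl := closure_convexHull_extremePoints hC hconv
  set S := convexHull ℝ (C.extremePoints ℝ) with hS
  have hSconv : Convex ℝ S := convex_convexHull ℝ _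
  have reduce : ∀ W : Submodule ℝ E, W < ⊤ → IsExtreme ℝ C (C ∩ {x | x - z ∈ W}) → False := by
    intro W hW hface
    refine hzS (mem_convexHull_extremePoints_of_isExtreme_inter hC hconv hz W hface ?_)
    intro D hD hDc
    exact ih _ (hn ▸ Submodule.finrank_lt hW.ne) W rfl D hD hDc
  by_cases hspan : affineSpan ℝ S = ⊤
  · have hint : (interior S).Nonempty := hSconv.interior_nonempty_iff_affineSpan_eq_top.2 hspan
    obtain ⟨f, hf⟩ := geometric_hahn_banach_point_open hSconv.interior isOpen_interior
      (fun h => hzS (interior_subset h))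
    have hle : ∀ x ∈ C, f z ≤ f x := by
      intro x hx
      rw [← hcl, ← hSconv.closure_interior_eq_closure_of_nonempty_interior hint] at hx
      exact closure_minimal (fun y hy => (hf y hy).le)
        (isClosed_le continuous_const f.continuous) hx
    refine reduce (LinearMap.ker (f : E →ₗ[ℝ] ℝ)) ?_ ?_
    · rw [lt_top_iff_ne_top, Ne, LinearMap.ker_eq_top]
      intro h0
      obtain ⟨y, hy⟩ := hint
      have h1 := hf y hy
      have h2 : ∀ x, f x = 0 := fun x => LinearMap.congr_fun h0 x
      rw [h2, h2] at h1
      exact lt_irrefl _ h1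
    · refine ⟨Set.inter_subset_left, ?_⟩
      rintro x hx y hy w ⟨hw, hwz⟩ hs
      refine ⟨hx, ?_⟩
      obtain ⟨a, b, ha, hb, hab, rfl⟩ := hs
      have h1 := hle x hx
      have h2 := hle y hy
      simp only [LinearMap.mem_ker, Set.mem_ofPred_eq, ContinuousLinearMap.coe_coe, map_sub, map_add,
        map_smul, smul_eq_mul] at hwz ⊢
      have hb' : b = 1 - a := by linarith
      subst hb'
      have h3 : a * (f x - f z) + (1 - a) * (f y - f z) = 0 := by linarith
      have h4 : 0 ≤ (1 - a) * (f y - f z) := mul_nonneg hb.le (by linarith)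
      have h5 : a * (f x - f z) ≤ 0 := by linarith
      have h6 : 0 ≤ f x - f z := by linarith
      by_contra h7
      have h8 : 0 < f x - f z := lt_of_le_of_ne h6 (Ne.symm h7)
      have := mul_pos ha h8
      linarith
  · have hSne : S.Nonempty := by
      rw [← closure_nonempty_iff, hcl]
      exact ⟨z, hz⟩
    have hCspan : C ⊆ affineSpan ℝ S := by
      rw [← hcl]
      exact closure_minimal (subset_affineSpan ℝ S) (AffineSubspace.closed_of_finiteDimensional _)
    refine reduce (affineSpan ℝ S).direction ?_ ?_
    · rw [lt_top_iff_ne_top, Ne, AffineSubspace.direction_eq_top_iff_of_nonempty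
        ((affineSpan_nonempty ℝ).2 hSne)]
      exact hspan
    · have : C ∩ {x | x - z ∈ (affineSpan ℝ S).direction} = C := by
        refine Set.inter_eq_left.2 fun x hx => ?_
        exact AffineSubspace.vsub_mem_direction (hCspan hx) (hCspan hz)
      rw [this]

/-- **Minkowski's theorem**: a compact convex set of a finite-dimensional space is the convex hull
of its extreme points. -/
theorem IsCompact.subset_convexHull_extremePoints {E : Type*} [NormedAddCommGroup E]
    [NormedSpace ℝ E] [FiniteDimensional ℝ E] {C : Set E} (hC : IsCompact C)
    (hconv : Convex ℝ C) : C ⊆ convexHull ℝ (C.extremePoints ℝ) :=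
  subset_convexHull_extremePoints_of_finrank _ E rfl C hC hconv

/-- Points of a compact set whose midpoint is close to an extreme point are close to that extreme
point. -/
theorem exists_dist_lt_of_midpoint_near_extremePoint {E : Type*} [NormedAddCommGroup E]
    [NormedSpace ℝ E] {C : Set E} (hC : IsCompact C) {e : E} (he : e ∈ C.extremePoints ℝ)
    {ε : ℝ} (hε : 0 < ε) :
    ∃ δ > 0, ∀ x ∈ C, ∀ y ∈ C, dist ((2⁻¹ : ℝ) • (x + y)) e < δ → dist x e < ε := by
  -- `δ` is the least distance from `e` to the midpoint of a pair in this compact set. It is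
  -- positive because `e` is the midpoint of no pair of points of `C` other than `(e, e)`.
  let S : Set (E × E) := (C ×ˢ C) ∩ {z | ε ≤ dist z.1 e}
  have hS : IsCompact S := (hC.prod hC).inter_right
    (isClosed_le continuous_const (continuous_fst.dist continuous_const))
  by_cases hne : S.Nonempty
  · obtain ⟨z, hz, hmin⟩ := hS.exists_isMinOn hne
      (f := fun z : E × E => dist ((2⁻¹ : ℝ) • (z.1 + z.2)) e) (by fun_prop)
    refine ⟨dist ((2⁻¹ : ℝ) • (z.1 + z.2)) e, ?_, fun x hx y hy hxy => ?_⟩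
    · rw [gt_iff_lt, dist_pos]
      intro h
      have h1 := ((mem_extremePoints.1 he).2 z.1 hz.1.1 z.2 hz.1.2
        ⟨2⁻¹, 2⁻¹, by norm_num, by norm_num, by norm_num, by rw [← smul_add, h]⟩).1
      have h2 : ε ≤ dist z.1 e := hz.2
      rw [h1, dist_self] at h2
      linarith
    · by_contra h
      exact absurd (hmin (a := (x, y)) ⟨⟨hx, hy⟩, not_lt.1 h⟩) (not_le.2 hxy)
  · refine ⟨1, one_pos, fun x hx y hy _ => ?_⟩
    by_contra h
    exact hne ⟨(x, y), ⟨hx, hy⟩, not_lt.1 h⟩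

end Minkowski

/-! ### Decomposable families: sets of integrals are convex and compact. -/

section Decomposable

/-- The function equal to `k₁` on `B` and to `k₂` off `B`. -/
noncomputable def splice {α E : Type*} [AddCommGroup E] (B : Set α) (k₁ k₂ : α → E) : α → E :=
  k₂ + B.indicator (k₁ - k₂)

theorem splice_of_mem {α E : Type*} [AddCommGroup E] {B : Set α} {k₁ k₂ : α → E} {s : α}
    (h : s ∈ B) : splice B k₁ k₂ s = k₁ s := by
  simp [splice, h]

theorem splice_of_notMem {α E : Type*} [AddCommGroup E] {B : Set α} {k₁ k₂ : α → E} {s : α}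
    (h : s ∉ B) : splice B k₁ k₂ s = k₂ s := by
  simp [splice, h]

/-- A nonempty closed set of `p`-integrable functions that is stable under splicing along
measurable sets and bounded by a `p`-integrable function. -/
structure IsDecomposableFamily {α E : Type*} [MeasurableSpace α] [NormedAddCommGroup E]
    (μ : Measure α) (p : ℝ) (K : Set (α → E)) (g : α → ℝ) : Prop where
  nonempty : K.Nonempty
  memLp : ∀ k ∈ K, MemLp k (ENNReal.ofReal p) μ
  mem_of_tendsto : ∀ u : ℕ → α → E, (∀ n, u n ∈ K) → ∀ k, MemLp k (ENNReal.ofReal p) μ →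
    Tendsto (fun n => eLpNorm (u n - k) (ENNReal.ofReal p) μ) atTop (𝓝 0) → k ∈ K
  splice_mem : ∀ B, MeasurableSet B → ∀ k₁ ∈ K, ∀ k₂ ∈ K, splice B k₁ k₂ ∈ K
  memLp_bound : MemLp g (ENNReal.ofReal p) μ
  norm_le : ∀ k ∈ K, ∀ᵐ s ∂μ, ‖k s‖ ≤ g s

/-- Dominated convergence in `L^p`. -/
theorem tendsto_eLpNorm_sub_of_dominated {α E : Type*} [MeasurableSpace α] [NormedAddCommGroup E]
    {μ : Measure α} {p : ℝ} (hp : 1 ≤ p) {u : ℕ → α → E} {k : α → E} {g : α → ℝ}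
    (hu : ∀ n, AEStronglyMeasurable (u n) μ) (hg : MemLp g (ENNReal.ofReal p) μ)
    (hle : ∀ n, ∀ᵐ s ∂μ, ‖u n s‖ ≤ g s)
    (hlim : ∀ᵐ s ∂μ, Tendsto (fun n => u n s) atTop (𝓝 (k s))) :
    MemLp k (ENNReal.ofReal p) μ ∧
      Tendsto (fun n => eLpNorm (u n - k) (ENNReal.ofReal p) μ) atTop (𝓝 0) := by
  have hp0 : 0 < p := zero_lt_one.trans_le hp
  have hk : AEStronglyMeasurable k μ := aestronglyMeasurable_of_tendsto_ae atTop hu hlim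
  have hkg : ∀ᵐ s ∂μ, ‖k s‖ ≤ g s := by
    filter_upwards [ae_all_iff.2 hle, hlim] with s h1 h2
    exact le_of_tendsto h2.norm (Eventually.of_forall h1)
  refine ⟨hg.mono' hk hkg, ?_⟩
  have hq0 : ENNReal.ofReal p ≠ 0 := by simpa using hp0
  have hqt : (ENNReal.ofReal p).toReal = p := ENNReal.toReal_ofReal hp0.le
  have h2g : MemLp (fun s => 2 * g s) (ENNReal.ofReal p) μ := hg.const_mul 2
  have hfin := lintegral_rpow_enorm_lt_top_of_eLpNorm_lt_top hq0 ENNReal.ofReal_ne_top h2g.2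
  rw [hqt] at hfin
  have key : Tendsto (fun n => ∫⁻ s, ‖(u n - k) s‖ₑ ^ p ∂μ) atTop (𝓝 (∫⁻ _, 0 ∂μ)) := by
    refine tendsto_lintegral_of_dominated_convergence' (fun s => ‖2 * g s‖ₑ ^ p)
      (fun n => (((hu n).sub hk).enorm.pow_const p)) (fun n => ?_) hfin.ne ?_
    · filter_upwards [hle n, hkg] with s h1 h2
      gcongr
      rw [enorm_le_iff_norm_le, Real.norm_eq_abs]
      refine (norm_sub_le _ _).trans (le_trans ?_ (le_abs_self _))
      linarith
    · filter_upwards [hlim] with s hs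
      have h1 : Tendsto (fun n => ‖(u n - k) s‖ₑ) atTop (𝓝 0) := by
        have := (tendsto_sub_nhds_zero_iff.2 hs).enorm
        simpa using this
      have h2 := (ENNReal.continuous_rpow_const (y := p)).tendsto 0
      rw [ENNReal.zero_rpow_of_pos hp0] at h2
      exact h2.comp h1
  rw [lintegral_zero] at key
  have h2 := (ENNReal.continuous_rpow_const (y := 1 / p)).tendsto 0
  rw [ENNReal.zero_rpow_of_pos (by positivity)] at h2
  refine (h2.comp key).congr fun n => ?_
  rw [eLpNorm_eq_lintegral_rpow_enorm_toReal hq0 ENNReal.ofReal_ne_top, hqt]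
  rfl

/-- A vector-valued function whose integrals over all measurable sets are small is small in
`L¹`. -/
theorem integral_norm_le_of_forall_norm_setIntegral_le {α : Type*} [MeasurableSpace α]
    {μ : Measure α} {d : ℕ} {v : α → EuclideanSpace ℝ (Fin d)} (hv : Integrable v μ) {ε : ℝ}
    (h : ∀ B, MeasurableSet B → ‖∫ s in B, v s ∂μ‖ ≤ ε) : ∫ s, ‖v s‖ ∂μ ≤ d * (2 * ε) := by
  have hi : ∀ i, Integrable (fun s => v s i) μ := fun i =>
    (EuclideanSpace.proj i : EuclideanSpace ℝ (Fin d) →L[ℝ] ℝ).integrable_comp hv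
  have hcoord : ∀ i, ∫ s, |v s i| ∂μ ≤ 2 * ε := by
    intro i
    have hB : ∀ B, MeasurableSet B → |∫ s in B, v s i ∂μ| ≤ ε := by
      intro B hB
      have h1 := (EuclideanSpace.proj i :
        EuclideanSpace ℝ (Fin d) →L[ℝ] ℝ).integral_comp_comm hv.restrict (μ := μ.restrict B)
      have h2 : ∫ s in B, v s i ∂μ = (∫ s in B, v s ∂μ) i := h1
      rw [h2, ← Real.norm_eq_abs]
      exact (PiLp.norm_apply_le _ i).trans (h B hB)
    set w := (hi i).1.mk _ with hw
    have hwm : Measurable w := (hi i).1.stronglyMeasurable_mk.measurable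
    have hvw : (fun s => v s i) =ᵐ[μ] w := (hi i).1.ae_eq_mk
    have hwi : Integrable w μ := (hi i).congr hvw
    -- Splitting by the sign of one coordinate leaves two integrals of size at most `ε`; this is the
    -- factor `2`, and the `d` coordinates give the other.
    have hP : MeasurableSet {s | 0 ≤ w s} := measurableSet_le measurable_const hwm
    have h1 : ∫ s, |v s i| ∂μ = ∫ s, |w s| ∂μ :=
      integral_congr_ae (hvw.mono fun s hs => congrArg abs hs)
    have h2 : ∀ B, ∫ s in B, v s i ∂μ = ∫ s in B, w s ∂μ := fun B =>
      integral_congr_ae (ae_restrict_of_ae hvw)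
    rw [h1, ← integral_add_compl hP hwi.abs]
    have h3 : ∫ s in {s | 0 ≤ w s}, |w s| ∂μ = ∫ s in {s | 0 ≤ w s}, w s ∂μ :=
      setIntegral_congr_fun hP fun s hs => abs_of_nonneg hs
    have h4 : ∫ s in {s | 0 ≤ w s}ᶜ, |w s| ∂μ = - ∫ s in {s | 0 ≤ w s}ᶜ, w s ∂μ := by
      rw [← integral_neg]
      refine setIntegral_congr_fun hP.compl fun s hs => abs_of_neg ?_
      exact not_le.1 hs
    rw [h3, h4, ← h2, ← h2]
    have h5 := hB _ hP
    have h6 := hB _ hP.compl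
    rw [abs_le] at h5 h6
    linarith [h5.2, h6.1]
  calc ∫ s, ‖v s‖ ∂μ ≤ ∫ s, ∑ i, |v s i| ∂μ := by
        refine integral_mono hv.norm (integrable_finsetSum _ fun i _ => (hi i).abs) fun s => ?_
        rw [EuclideanSpace.norm_eq, Real.sqrt_le_left (Finset.sum_nonneg fun _ _ => abs_nonneg _)]
        exact Finset.sum_sq_le_sq_sum_of_nonneg fun _ _ => abs_nonneg _
    _ = ∑ i, ∫ s, |v s i| ∂μ := integral_finsetSum _ fun i _ => (hi i).abs
    _ ≤ ∑ _i : Fin d, 2 * ε := Finset.sum_le_sum fun i _ => hcoord i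
    _ = d * (2 * ε) := by simp

namespace IsDecomposableFamily

variable {d : ℕ} {μ : Measure ℝ} [IsFiniteMeasure μ] {p : ℝ}
  {K : Set (ℝ → EuclideanSpace ℝ (Fin d))} {g : ℝ → ℝ}

theorem integrable (hK : IsDecomposableFamily μ p K g) (hp : 1 ≤ p) {k} (hk : k ∈ K) :
    Integrable k μ :=
  (hK.memLp k hk).integrable (by simpa using hp)

theorem integrable_bound (hK : IsDecomposableFamily μ p K g) (hp : 1 ≤ p) : Integrable g μ :=
  hK.memLp_bound.integrable (by simpa using hp)

theorem setIntegral_splice (hK : IsDecomposableFamily μ p K g) (hp : 1 ≤ p) {B : Set ℝ}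
    (hB : MeasurableSet B) {k₁ k₂} (h₁ : k₁ ∈ K) (h₂ : k₂ ∈ K) (A : Set ℝ) :
    ∫ s in A, splice B k₁ k₂ s ∂μ =
      ∫ s in A, k₂ s ∂μ + ∫ s in B, (k₁ s - k₂ s) ∂(μ.restrict A) := by
  have i1 := (hK.integrable hp h₁).restrict (s := A)
  have i2 := (hK.integrable hp h₂).restrict (s := A)
  rw [← integral_indicator hB]
  exact integral_add i2 ((i1.sub i2).indicator hB)

/-- Lyapunov provides `B` with `∫_B (k₁ - k₂) = a ∫ (k₁ - k₂)` over `A`; splicing along `B` then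
realises the convex combination. -/
theorem convex_image_setIntegral [NullSingletonClass μ] (hK : IsDecomposableFamily μ p K g)
    (hp : 1 ≤ p) (A : Set ℝ) : Convex ℝ ((fun k => ∫ s in A, k s ∂μ) '' K) := by
  rintro _ ⟨k₁, h₁, rfl⟩ _ ⟨k₂, h₂, rfl⟩ a b ha hb hab
  have i1 := (hK.integrable hp h₁).restrict (s := A)
  have i2 := (hK.integrable hp h₂).restrict (s := A)
  have : NullSingletonClass (μ.restrict A) :=
    ⟨fun x => Measure.restrict_le_self.absolutelyContinuous (measure_singleton x)⟩
  obtain ⟨B, hB, h⟩ := exists_setIntegral_eq_smul (i1.sub i2) ha (by linarith)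
  refine ⟨splice B k₁ k₂, hK.splice_mem B hB k₁ h₁ k₂ h₂, ?_⟩
  simp only [Pi.sub_apply] at h
  simp only [hK.setIntegral_splice hp hB h₁ h₂, h]
  rw [integral_sub i1 i2]
  have : b = 1 - a := by linarith
  rw [this, smul_sub, sub_smul, one_smul]
  abel

theorem mem_of_tendsto_ae (hK : IsDecomposableFamily μ p K g) (hp : 1 ≤ p)
    {u : ℕ → ℝ → EuclideanSpace ℝ (Fin d)} (hu : ∀ n, u n ∈ K) {k}
    (hlim : ∀ᵐ s ∂μ, Tendsto (fun n => u n s) atTop (𝓝 (k s))) :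
    k ∈ K ∧ ∀ A, Tendsto (fun n => ∫ s in A, u n s ∂μ) atTop (𝓝 (∫ s in A, k s ∂μ)) := by
  obtain ⟨h1, h2⟩ := tendsto_eLpNorm_sub_of_dominated hp
    (fun n => (hK.memLp _ (hu n)).1) hK.memLp_bound (fun n => hK.norm_le _ (hu n)) hlim
  refine ⟨hK.mem_of_tendsto u hu k h1 h2, fun A => ?_⟩
  exact tendsto_integral_of_dominated_convergence g
    (fun n => (hK.memLp _ (hu n)).1.restrict) (hK.integrable_bound hp).restrict
    (fun n => ae_restrict_of_ae (hK.norm_le _ (hu n))) (ae_restrict_of_ae hlim)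

theorem norm_setIntegral_le (hK : IsDecomposableFamily μ p K g) (hp : 1 ≤ p) {k} (hk : k ∈ K)
    (A : Set ℝ) : ‖∫ s in A, k s ∂μ‖ ≤ ∫ s in A, g s ∂μ :=
  norm_integral_le_of_norm_le (hK.integrable_bound hp).restrict
    (ae_restrict_of_ae (hK.norm_le k hk))

theorem isCompact_closure_image_setIntegral (hK : IsDecomposableFamily μ p K g) (hp : 1 ≤ p)
    (A : Set ℝ) : IsCompact (closure ((fun k => ∫ s in A, k s ∂μ) '' K)) := by
  refine Metric.isCompact_of_isClosed_isBounded isClosed_closure (Bornology.IsBounded.closure ?_)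
  refine (Metric.isBounded_closedBall (x := (0 : EuclideanSpace ℝ (Fin d)))
    (r := ∫ s in A, g s ∂μ)).subset ?_
  rintro _ ⟨k, hk, rfl⟩
  rw [mem_closedBall_zero_iff]
  exact hK.norm_setIntegral_le hp hk A

/-- Let `∫_A k n → e`. Exchanging `k m` and `k n` on a set `B` preserves the midpoint of their
integrals, which is near `e`. By extremality the integral of each splice is near `e` too, so `∫_{A ∩
B} (k m - k n)` is small uniformly in `B`. Hence `k n` is Cauchy in `L¹(A)`, and its limit yields a
member of `K` with integral `e`. -/
theorem extremePoints_closure_subset (hK : IsDecomposableFamily μ p K g) (hp : 1 ≤ p)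
    {A : Set ℝ} (hA : MeasurableSet A) :
    (closure ((fun k => ∫ s in A, k s ∂μ) '' K)).extremePoints ℝ ⊆
      (fun k => ∫ s in A, k s ∂μ) '' K := by
  intro e he
  set C := closure ((fun k => ∫ s in A, k s ∂μ) '' K)
  have hC : IsCompact C := hK.isCompact_closure_image_setIntegral hp A
  have hCmem : ∀ k ∈ K, ∫ s in A, k s ∂μ ∈ C := fun k hk => subset_closure ⟨k, hk, rfl⟩
  obtain ⟨z, hz, hze⟩ := mem_closure_iff_seq_limit.1 he.1
  choose k hk hkz using hz
  simp only at hkz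
  have hkint : ∀ n, Integrable (k n) (μ.restrict A) := fun n => (hK.integrable hp (hk n)).restrict
  have hcauchy : CauchySeq fun n => (hkint n).toL1 (k n) := by
    rw [Metric.cauchySeq_iff]
    intro ε hε
    -- Chosen so that the bound `d * (2 * (2 * η))` obtained below is less than `ε`; the `+ 1` also
    -- covers `d = 0`.
    set η : ℝ := ε / (d * 4 + 1) with hη
    have hη0 : 0 < η := by positivity
    obtain ⟨δ, hδ, hmid⟩ := exists_dist_lt_of_midpoint_near_extremePoint hC he hη0
    obtain ⟨N, hN⟩ := Metric.tendsto_atTop.1 hze (min δ η) (lt_min hδ hη0)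
    refine ⟨N, fun m hm n hn => ?_⟩
    rw [dist_eq_norm, ← Integrable.toL1_sub _ _ (hkint m) (hkint n), L1.norm_of_fun_eq_integral_norm]
    have hle : ∫ s in A, ‖(k m - k n) s‖ ∂μ ≤ d * (2 * (2 * η)) := by
      refine integral_norm_le_of_forall_norm_setIntegral_le ((hkint m).sub (hkint n)) fun B hB => ?_
      have e1 := hK.setIntegral_splice hp hB (hk m) (hk n) A
      have e2 := hK.setIntegral_splice hp hB (hk n) (hk m) A
      have e3 : ∫ s in B, (k n s - k m s) ∂(μ.restrict A) =
          - ∫ s in B, (k m s - k n s) ∂(μ.restrict A) := by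
        rw [← integral_neg]
        simp
      rw [e3] at e2
      have h1 := hmid _ (hCmem _ (hK.splice_mem B hB _ (hk m) _ (hk n)))
        _ (hCmem _ (hK.splice_mem B hB _ (hk n) _ (hk m))) (by
          rw [e1, e2, hkz, hkz]
          have a1 := (hN m hm).trans_le (min_le_left _ _)
          have a2 := (hN n hn).trans_le (min_le_left _ _)
          rw [dist_eq_norm] at a1 a2 ⊢
          have : (2⁻¹ : ℝ) • (z n + ∫ s in B, (k m s - k n s) ∂(μ.restrict A) +
              (z m + -∫ s in B, (k m s - k n s) ∂(μ.restrict A))) - e =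
              (2⁻¹ : ℝ) • ((z m - e) + (z n - e)) := by
            module
          rw [this, norm_smul]
          have a3 := norm_add_le (z m - e) (z n - e)
          rw [Real.norm_of_nonneg (by norm_num : (0:ℝ) ≤ 2⁻¹)]
          linarith)
      rw [e1, hkz] at h1
      have h2 := (hN n hn).trans_le (min_le_right _ _)
      rw [dist_eq_norm] at h1 h2
      have h3 : ∫ s in B, (k m - k n) s ∂(μ.restrict A) =
          (z n + ∫ s in B, (k m s - k n s) ∂(μ.restrict A) - e) - (z n - e) := by
        simp
      rw [h3]
      refine (norm_sub_le _ _).trans ?_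
      linarith
    refine hle.trans_lt ?_
    have : (d : ℝ) * (2 * (2 * η)) = ε * (d * 4) / (d * 4 + 1) := by
      rw [hη]
      ring
    rw [this, div_lt_iff₀ (by positivity)]
    nlinarith
  obtain ⟨F, hF⟩ := cauchySeq_tendsto_of_complete hcauchy
  have hmeas : TendstoInMeasure (μ.restrict A) (fun n => (((hkint n).toL1 (k n) : Lp _ 1 _) : ℝ → _))
      atTop F := tendstoInMeasure_of_tendsto_Lp hF
  obtain ⟨ns, hns, hae⟩ := hmeas.exists_seq_tendsto_ae
  have hae' : ∀ᵐ s ∂(μ.restrict A), Tendsto (fun i => k (ns i) s) atTop (𝓝 (F s)) := by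
    filter_upwards [hae, ae_all_iff.2 fun n => (hkint n).coeFn_toL1] with s h1 h2
    simpa only [h2] using h1
  -- Convergence is known only on `A`, so the sequence is frozen to `k 0` outside `A`.
  have hu : ∀ n, splice A (k (ns n)) (k 0) ∈ K := fun n => hK.splice_mem A hA _ (hk _) _ (hk _)
  have hlim : ∀ᵐ s ∂μ, Tendsto (fun n => splice A (k (ns n)) (k 0) s) atTop
      (𝓝 (splice A F (k 0) s)) := by
    filter_upwards [(ae_restrict_iff' hA).1 hae'] with s hs
    by_cases hsA : s ∈ A
    · simpa only [splice_of_mem hsA] using hs hsA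
    · simpa only [splice_of_notMem hsA] using tendsto_const_nhds
  obtain ⟨hmem, hint⟩ := hK.mem_of_tendsto_ae hp hu hlim
  refine ⟨_, hmem, tendsto_nhds_unique (hint A) ?_⟩
  refine (hze.comp hns.tendsto_atTop).congr fun n => ?_
  rw [Function.comp_apply, ← hkz]
  exact setIntegral_congr_fun hA fun s hs => (splice_of_mem hs).symm

theorem isCompact_image_setIntegral [NullSingletonClass μ] (hK : IsDecomposableFamily μ p K g)
    (hp : 1 ≤ p) {A : Set ℝ} (hA : MeasurableSet A) :
    IsCompact ((fun k => ∫ s in A, k s ∂μ) '' K) := by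
  have hC := hK.isCompact_closure_image_setIntegral hp A
  have hconv := hK.convex_image_setIntegral hp A
  have hsub := (hC.subset_convexHull_extremePoints hconv.closure).trans
    (convexHull_min (hK.extremePoints_closure_subset hp hA) hconv)
  rwa [subset_antisymm hsub subset_closure] at hC

end IsDecomposableFamily

end Decomposable

/-! ### Support functions and Hausdorff convergence. -/

section SupportFunction

/-- The support function `u ↦ sup_{x ∈ S} ⟪u, x⟫` of a set. -/
noncomputable def supportFn {E : Type*} [NormedAddCommGroup E] [InnerProductSpace ℝ E] (S : Set E)
    (u : E) : ℝ :=
  sSup ((fun x => inner ℝ u x) '' S)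

variable {E : Type*} [NormedAddCommGroup E] [InnerProductSpace ℝ E]

theorem bddAbove_image_inner {S : Set E} {M : ℝ} (hS : ∀ x ∈ S, ‖x‖ ≤ M) (u : E) :
    BddAbove ((fun x => inner ℝ u x) '' S) := by
  refine ⟨‖u‖ * M, ?_⟩
  rintro _ ⟨x, hx, rfl⟩
  exact (real_inner_le_norm u x).trans (by gcongr; exact hS x hx)

theorem inner_le_supportFn {S : Set E} {M : ℝ} (hS : ∀ x ∈ S, ‖x‖ ≤ M) (u : E) {x : E}
    (hx : x ∈ S) : inner ℝ u x ≤ supportFn S u :=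
  le_csSup (bddAbove_image_inner hS u) ⟨x, hx, rfl⟩

theorem supportFn_le {S : Set E} (hne : S.Nonempty) {u : E} {b : ℝ}
    (h : ∀ x ∈ S, inner ℝ u x ≤ b) : supportFn S u ≤ b :=
  csSup_le (hne.image _) (by rintro _ ⟨x, hx, rfl⟩; exact h x hx)

theorem supportFn_le_add {S : Set E} (hne : S.Nonempty) {M : ℝ} (hS : ∀ x ∈ S, ‖x‖ ≤ M)
    (u v : E) : supportFn S u ≤ supportFn S v + ‖u - v‖ * M := by
  refine supportFn_le hne fun x hx => ?_
  have h1 := inner_le_supportFn hS v hx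
  have h2 : inner ℝ u x = inner ℝ v x + inner ℝ (u - v) x := by
    rw [← inner_add_left, add_sub_cancel]
  have h3 := real_inner_le_norm (u - v) x
  have h4 : ‖u - v‖ * ‖x‖ ≤ ‖u - v‖ * M := by
    gcongr
    exact hS x hx
  linarith

/-- Take the nearest point `y`. In the direction of `x - y` the support function of `S` is attained
at `y`, so the hypothesis for the unit vector in that direction bounds `‖x - y‖`. -/
theorem exists_dist_le_of_inner_le_supportFn {S : Set E} (hne : S.Nonempty) (hc : IsCompact S)
    (hconv : Convex ℝ S) {x : E} {ε : ℝ}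
    (h : ∀ u : E, ‖u‖ ≤ 1 → inner ℝ u x ≤ supportFn S u + ε) (hε : 0 ≤ ε) :
    ∃ y ∈ S, dist x y ≤ ε := by
  obtain ⟨y, hy, hmin⟩ := exists_norm_eq_iInf_of_complete_convex hne hc.isComplete hconv x
  refine ⟨y, hy, ?_⟩
  have hproj := (norm_eq_iInf_iff_real_inner_le_zero hconv hy).1 hmin
  rw [dist_eq_norm]
  by_cases hv : x - y = 0
  · simpa [hv] using hε
  have hpos : 0 < ‖x - y‖ := norm_pos_iff.2 hv
  have h1 := h (‖x - y‖⁻¹ • (x - y)) (by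
    rw [norm_smul, norm_inv, norm_norm, inv_mul_cancel₀ hpos.ne'])
  have h2 : supportFn S (‖x - y‖⁻¹ • (x - y)) ≤ inner ℝ (‖x - y‖⁻¹ • (x - y)) y := by
    refine supportFn_le hne fun w hw => ?_
    have h3 := hproj w hw
    rw [inner_sub_right] at h3
    rw [real_inner_smul_left, real_inner_smul_left]
    gcongr
    linarith
  have h4 : inner ℝ (‖x - y‖⁻¹ • (x - y)) (x - y) ≤ ε := by
    rw [inner_sub_right]
    linarith
  rwa [real_inner_smul_left, real_inner_self_eq_norm_sq, pow_two, inv_mul_cancel_left₀ hpos.ne']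
    at h4

theorem dist_convexBody_le_of_abs_supportFn_sub_le {A B : ConvexBody E} {ε : ℝ} (hε : 0 ≤ ε)
    (h : ∀ u : E, ‖u‖ ≤ 1 → |supportFn (A : Set E) u - supportFn (B : Set E) u| ≤ ε) :
    dist A B ≤ ε := by
  obtain ⟨M, hM⟩ := A.isBounded.exists_norm_le
  obtain ⟨N, hN⟩ := B.isBounded.exists_norm_le
  rw [← ConvexBody.hausdorffDist_coe]
  refine Metric.hausdorffDist_le_of_mem_dist hε (fun x hx => ?_) fun x hx => ?_
  · refine exists_dist_le_of_inner_le_supportFn B.nonempty B.isCompact B.convex (fun u hu => ?_) hε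
    have h1 := inner_le_supportFn hM u hx
    have h2 := (abs_le.1 (h u hu)).2
    linarith
  · refine exists_dist_le_of_inner_le_supportFn A.nonempty A.isCompact A.convex (fun u hu => ?_) hε
    have h1 := inner_le_supportFn hN u hx
    have h2 := (abs_le.1 (h u hu)).1
    linarith

/-- Uniformly bounded convex bodies whose support functions converge on a dense set converge in
the Hausdorff metric. -/
theorem tendsto_convexBody_of_tendsto_supportFn [FiniteDimensional ℝ E] {ι : Type*} {l : Filter ι}
    {A : ι → ConvexBody E} {D : ConvexBody E} {M : ℝ} (hA : ∀ᶠ i in l, ∀ x ∈ A i, ‖x‖ ≤ M)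
    (hD : ∀ x ∈ D, ‖x‖ ≤ M) {Q : Set E} (hQ : Dense Q)
    (h : ∀ u ∈ Q, Tendsto (fun i => supportFn (A i : Set E) u) l (𝓝 (supportFn (D : Set E) u))) :
    Tendsto A l (𝓝 D) := by
  rw [Metric.tendsto_nhds]
  intro ε hε
  obtain ⟨x₀, hx₀⟩ := D.nonempty
  have hM0 : 0 ≤ M := (norm_nonneg _).trans (hD x₀ hx₀)
  set η : ℝ := ε / (2 * M + 2) with hη
  have hη0 : 0 < η := by positivity
  -- A finite `η`-net of the unit ball with centres in `Q`. Both support functions are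
  -- `M`-Lipschitz, so passing to a net point costs `2 * M * η`, and convergence at the net points
  -- costs a further `η`.
  obtain ⟨F, hFQ, hcover⟩ := (isCompact_closedBall (0 : E) 1).elim_finite_subcover_image
    (b := Q) (c := fun q => Metric.ball q η) (fun q _ => Metric.isOpen_ball) (by
      intro u _
      obtain ⟨q, hq, hqu⟩ := hQ.exists_dist_lt u hη0
      exact Set.mem_biUnion hq (Metric.mem_ball.2 hqu))
  obtain ⟨hFfin, hcover⟩ := hcover
  have hev : ∀ᶠ i in l, ∀ q ∈ F, |supportFn (A i : Set E) q - supportFn (D : Set E) q| < η := by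
    refine (eventually_all_finite hFfin).2 fun q hq => ?_
    have := (Metric.tendsto_nhds.1 (h q (hFQ hq))) η hη0
    simpa only [Real.dist_eq] using this
  filter_upwards [hev, hA] with i hi hAi
  refine (dist_convexBody_le_of_abs_supportFn_sub_le (ε := (2 * M + 1) * η) (by positivity)
    fun u hu => ?_).trans_lt ?_
  · obtain ⟨q, hq, huq⟩ := Set.mem_iUnion₂.1 (hcover (mem_closedBall_zero_iff.2 hu))
    have h0 := abs_lt.1 (hi q hq)
    rw [Metric.mem_ball, dist_eq_norm] at huq
    have huq' : ‖q - u‖ < η := by rwa [norm_sub_rev]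
    have h1 := supportFn_le_add (A i).nonempty hAi u q
    have h2 := supportFn_le_add (A i).nonempty hAi q u
    have h3 := supportFn_le_add D.nonempty hD u q
    have h4 := supportFn_le_add D.nonempty hD q u
    have h5 : ‖u - q‖ * M ≤ η * M := by gcongr
    have h6 : ‖q - u‖ * M ≤ η * M := by gcongr
    rw [abs_le]
    constructor <;> nlinarith [h0.1, h0.2]
  · rw [hη, mul_div_assoc', div_lt_iff₀ (by positivity)]
    nlinarith

theorem supportFn_smul {S : Set E} {c : ℝ} (hc : 0 ≤ c) (u : E) :
    supportFn (c • S) u = c * supportFn S u := by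
  unfold supportFn
  have : (fun x => inner ℝ u x) '' (c • S) = c • ((fun x => inner ℝ u x) '' S) := by
    ext r
    simp [Set.mem_smul_set, real_inner_smul_right]
  rw [this, Real.sSup_smul_of_nonneg hc, smul_eq_mul]

theorem supportFn_closedConvexHull {S : Set E} (hne : S.Nonempty) {M : ℝ}
    (hS : ∀ x ∈ S, ‖x‖ ≤ M) (u : E) : supportFn (closedConvexHull ℝ S) u = supportFn S u := by
  have hsub : closedConvexHull ℝ S ⊆ {x | inner ℝ u x ≤ supportFn S u} := by
    refine closedConvexHull_min (fun x hx => inner_le_supportFn hS u hx) ?_ ?_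
    · intro x hx y hy a b ha hb hab
      simp only [Set.mem_ofPred_eq, inner_add_right, real_inner_smul_right] at hx hy ⊢
      calc a * inner ℝ u x + b * inner ℝ u y ≤ a * supportFn S u + b * supportFn S u := by gcongr
        _ = supportFn S u := by rw [← add_mul, hab, one_mul]
    · exact isClosed_le (by fun_prop) continuous_const
  have hM : ∀ x ∈ closedConvexHull ℝ S, ‖x‖ ≤ M := by
    intro x hx
    have := closedConvexHull_min (t := Metric.closedBall (0 : E) M)
      (fun y hy => mem_closedBall_zero_iff.2 (hS y hy)) (convex_closedBall _ _)
      Metric.isClosed_closedBall hx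
    exact mem_closedBall_zero_iff.1 this
  refine le_antisymm (supportFn_le (hne.mono subset_closedConvexHull) hsub) ?_
  exact supportFn_le hne fun x hx => inner_le_supportFn hM u (subset_closedConvexHull hx)

theorem supportFn_closure {S : Set E} (hne : S.Nonempty) {M : ℝ}
    (hS : ∀ x ∈ S, ‖x‖ ≤ M) (u : E) : supportFn (closure S) u = supportFn S u := by
  have hsub : closure S ⊆ {x | inner ℝ u x ≤ supportFn S u} :=
    closure_minimal (fun x hx => inner_le_supportFn hS u hx)
      (isClosed_le (by fun_prop) continuous_const)
  have hM : ∀ x ∈ closure S, ‖x‖ ≤ M := fun x hx =>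
    closure_minimal (t := {x | ‖x‖ ≤ M}) hS (isClosed_le continuous_norm continuous_const) hx
  refine le_antisymm (supportFn_le hne.closure hsub) ?_
  exact supportFn_le hne fun x hx => inner_le_supportFn hM u (subset_closure hx)

end SupportFunction

/-! ### Pointwise dense sequences and a common dominating function. -/

section Selection

variable {α E : Type*} [MeasurableSpace α] [NormedAddCommGroup E]

theorem splice_stronglyMeasurable {B : Set α} (hB : MeasurableSet B) {k₁ k₂ : α → E}
    (h₁ : StronglyMeasurable k₁) (h₂ : StronglyMeasurable k₂) :
    StronglyMeasurable (splice B k₁ k₂) :=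
  h₂.add ((h₁.sub h₂).indicator hB)

/-- Splicing selects a pointwise maximiser of `φ` among finitely many members. It is used with the
norm to dominate `K`, and with `⟪u, ·⟫` to reach support functions. -/
theorem exists_mem_forall_le {K : Set (α → E)}
    (hsplice : ∀ B, MeasurableSet B → ∀ k₁ ∈ K, ∀ k₂ ∈ K, splice B k₁ k₂ ∈ K)
    {f : ℕ → α → E} (hf : ∀ n, StronglyMeasurable (f n)) (hfK : ∀ n, f n ∈ K) {φ : E → ℝ}
    (hφ : Continuous φ) (N : ℕ) :
    ∃ h ∈ K, StronglyMeasurable h ∧ ∀ s, ∀ n ≤ N, φ (f n s) ≤ φ (h s) := by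
  induction N with
  | zero =>
    refine ⟨f 0, hfK 0, hf 0, fun s n hn => ?_⟩
    rw [Nat.le_zero.1 hn]
  | succ N ih =>
    obtain ⟨h, hK, hm, hle⟩ := ih
    have hB : MeasurableSet {s | φ (h s) ≤ φ (f (N + 1) s)} :=
      measurableSet_le (hφ.comp_stronglyMeasurable hm).measurable
        (hφ.comp_stronglyMeasurable (hf (N + 1))).measurable
    refine ⟨splice {s | φ (h s) ≤ φ (f (N + 1) s)} (f (N + 1)) h, hsplice _ hB _ (hfK _) _ hK,
      splice_stronglyMeasurable hB (hf _) hm, fun s n hn => ?_⟩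
    by_cases hs : s ∈ {s | φ (h s) ≤ φ (f (N + 1) s)}
    · rw [splice_of_mem hs]
      rcases Nat.le_succ_iff.1 hn with hn | rfl
      · exact (hle s n hn).trans hs
      · exact le_rfl
    · rw [splice_of_notMem hs]
      rcases Nat.le_succ_iff.1 hn with hn | rfl
      · exact hle s n hn
      · exact (not_le.1 hs).le

/-- Each finite maximum is dominated by the norm of a single member of `K`, so it obeys the bound
`C`; monotone convergence does the rest. -/
theorem lintegral_iSup_enorm_rpow_le {μ : Measure α} {p : ℝ} (hp : 1 ≤ p) {K : Set (α → E)}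
    (hsplice : ∀ B, MeasurableSet B → ∀ k₁ ∈ K, ∀ k₂ ∈ K, splice B k₁ k₂ ∈ K) {C : ℝ≥0∞}
    (hbdd : ∀ k ∈ K, eLpNorm k (ENNReal.ofReal p) μ ≤ C)
    {f : ℕ → α → E} (hf : ∀ n, StronglyMeasurable (f n)) (hfK : ∀ n, f n ∈ K) :
    ∫⁻ s, (⨆ n, ‖f n s‖ₑ) ^ p ∂μ ≤ C ^ p := by
  have hp0 : 0 < p := zero_lt_one.trans_le hp
  have hq0 : ENNReal.ofReal p ≠ 0 := by simpa using hp0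
  have hqt : (ENNReal.ofReal p).toReal = p := ENNReal.toReal_ofReal hp0.le
  let a : ℕ → α → ℝ≥0∞ := fun n s => ‖f n s‖ₑ ^ p
  have ha : ∀ n, Measurable (a n) := fun n => (hf n).enorm.pow_const p
  have hP : ∀ N, Measurable (partialSups a N) := by
    intro N
    induction N with
    | zero => simpa using ha 0
    | succ N ih =>
      rw [partialSups_add_one]
      exact ih.sup (ha _)
  have hsup : ∀ s, (⨆ n, ‖f n s‖ₑ) ^ p = ⨆ N, partialSups a N s := by
    intro s
    have h1 := (ENNReal.orderIsoRpow p hp0).map_iSup fun n => ‖f n s‖ₑ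
    simp only [ENNReal.orderIsoRpow_apply] at h1
    rw [h1]
    have h2 : (⨆ N, partialSups a N) = ⨆ n, a n := iSup_partialSups_eq a
    have h3 := congrFun h2 s
    simp only [iSup_apply] at h3
    exact h3.symm
  simp only [hsup]
  rw [lintegral_iSup hP (partialSups_monotone a)]
  refine iSup_le fun N => ?_
  obtain ⟨h, hK, hm, hle⟩ := exists_mem_forall_le hsplice hf hfK continuous_norm N
  have hb := hbdd h hK
  rw [eLpNorm_eq_lintegral_rpow_enorm_toReal hq0 ENNReal.ofReal_ne_top, hqt, one_div,
    ENNReal.rpow_inv_le_iff hp0] at hb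
  refine le_trans (lintegral_mono fun s => ?_) hb
  have : partialSups a N ≤ fun s => ‖h s‖ₑ ^ p := by
    refine partialSups_le _ _ _ fun n hn s => ?_
    refine ENNReal.rpow_le_rpow ?_ hp0.le
    rw [enorm_le_iff_norm_le]
    exact hle s n hn
  exact this s

/-- `L^p` is separable, and a sequence converging in `L^p` has a subsequence converging almost
everywhere. -/
theorem exists_dense_sequence [SecondCountableTopology E] {μ : Measure α} [IsSeparable μ]
    {p : ℝ} (hp : 1 ≤ p) {K : Set (α → E)} (hne : K.Nonempty)
    (hLp : ∀ k ∈ K, MemLp k (ENNReal.ofReal p) μ)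
    (hclosed : ∀ u : ℕ → α → E, (∀ n, u n ∈ K) → ∀ k, MemLp k (ENNReal.ofReal p) μ →
      Tendsto (fun n => eLpNorm (u n - k) (ENNReal.ofReal p) μ) atTop (𝓝 0) → k ∈ K) :
    ∃ f : ℕ → α → E, (∀ n, StronglyMeasurable (f n)) ∧ (∀ n, f n ∈ K) ∧
      ∀ k ∈ K, ∀ᵐ s ∂μ, k s ∈ closure (Set.range fun n => f n s) := by
  have : Fact (1 ≤ ENNReal.ofReal p) := ⟨by simpa using hp⟩
  have : Fact (ENNReal.ofReal p ≠ ⊤) := ⟨ENNReal.ofReal_ne_top⟩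
  -- Closedness under constant sequences makes `K` insensitive to null sets, so the representatives
  -- chosen by `Lp` stay in `K`.
  have hcongr : ∀ k ∈ K, ∀ k' : α → E, MemLp k' (ENNReal.ofReal p) μ → k =ᵐ[μ] k' → k' ∈ K := by
    intro k hk k' hk' h
    refine hclosed (fun _ => k) (fun _ => hk) k' hk' ?_
    have : eLpNorm (k - k') (ENNReal.ofReal p) μ = 0 := by
      rw [eLpNorm_congr_ae (g := 0) (h.mono fun s hs => by simp [hs])]
      simp
    rw [this]
    exact tendsto_const_nhds
  let S : Set (Lp E (ENNReal.ofReal p) μ) := {x | (x : α → E) ∈ K}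
  have hS : ∀ k (hk : k ∈ K), (hLp k hk).toLp k ∈ S := fun k hk =>
    hcongr k hk _ (Lp.memLp _) (hLp k hk).coeFn_toLp.symm
  have : Nonempty S := by
    obtain ⟨k, hk⟩ := hne
    exact ⟨⟨_, hS k hk⟩⟩
  refine ⟨fun n => ((TopologicalSpace.denseSeq S n : Lp E (ENNReal.ofReal p) μ) : α → E),
    fun n => Lp.stronglyMeasurable _, fun n => (TopologicalSpace.denseSeq S n).2, fun k hk => ?_⟩
  have hd : (⟨_, hS k hk⟩ : S) ∈ closure (Set.range (TopologicalSpace.denseSeq S)) :=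
    TopologicalSpace.denseRange_denseSeq S _
  obtain ⟨x, hx, hxlim⟩ := mem_closure_iff_seq_limit.1 hd
  choose m hm using hx
  have hlim : Tendsto (fun n => (x n : Lp E (ENNReal.ofReal p) μ)) atTop
      (𝓝 ((hLp k hk).toLp k)) := (continuous_subtype_val.tendsto _).comp hxlim
  obtain ⟨ns, -, hae⟩ := (tendstoInMeasure_of_tendsto_Lp hlim).exists_seq_tendsto_ae
  filter_upwards [hae, (hLp k hk).coeFn_toLp] with s h1 h2
  rw [h2] at h1
  refine mem_closure_of_tendsto h1 (Eventually.of_forall fun i => ⟨m (ns i), ?_⟩)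
  simp only [hm]

/-- An `L^p`-bounded closed family of functions that is stable under splicing is dominated by a
single `p`-integrable function, and has a countable subfamily whose values are dense in the set
of values of every member. -/
theorem exists_isDecomposableFamily [SecondCountableTopology E] {μ : Measure α} [IsSeparable μ]
    {p : ℝ} (hp : 1 ≤ p) {K : Set (α → E)} (hne : K.Nonempty)
    (hLp : ∀ k ∈ K, MemLp k (ENNReal.ofReal p) μ)
    (hclosed : ∀ u : ℕ → α → E, (∀ n, u n ∈ K) → ∀ k, MemLp k (ENNReal.ofReal p) μ →
      Tendsto (fun n => eLpNorm (u n - k) (ENNReal.ofReal p) μ) atTop (𝓝 0) → k ∈ K)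
    (hsplice : ∀ B, MeasurableSet B → ∀ k₁ ∈ K, ∀ k₂ ∈ K, splice B k₁ k₂ ∈ K) {C : ℝ≥0∞}
    (hC : C ≠ ⊤) (hbdd : ∀ k ∈ K, eLpNorm k (ENNReal.ofReal p) μ ≤ C) :
    ∃ (f : ℕ → α → E) (g : α → ℝ), IsDecomposableFamily μ p K g ∧
      (∀ n, StronglyMeasurable (f n)) ∧ (∀ n, f n ∈ K) ∧
      (∀ k ∈ K, ∀ᵐ s ∂μ, k s ∈ closure (Set.range fun n => f n s)) ∧
      Measurable g ∧ ∀ᵐ s ∂μ, ∀ n, ‖f n s‖ ≤ g s := by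
  have hp0 : 0 < p := zero_lt_one.trans_le hp
  have hq0 : ENNReal.ofReal p ≠ 0 := by simpa using hp0
  have hqt : (ENNReal.ofReal p).toReal = p := ENNReal.toReal_ofReal hp0.le
  obtain ⟨f, hfm, hfK, hdense⟩ := exists_dense_sequence hp hne hLp hclosed
  have hG := lintegral_iSup_enorm_rpow_le hp hsplice hbdd hfm hfK
  have hGm : Measurable fun s => ⨆ n, ‖f n s‖ₑ := Measurable.iSup fun n => (hfm n).enorm
  have hCp : C ^ p < ⊤ := ENNReal.rpow_lt_top_of_nonneg hp0.le hC
  have hfin : ∀ᵐ s ∂μ, (⨆ n, ‖f n s‖ₑ) < ⊤ := by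
    filter_upwards [ae_lt_top (hGm.pow_const p) (hG.trans_lt hCp).ne] with s hs
    rwa [ENNReal.rpow_lt_top_iff_of_pos hp0] at hs
  have hfg : ∀ᵐ s ∂μ, ∀ n, ‖f n s‖ ≤ (⨆ n, ‖f n s‖ₑ).toReal := by
    filter_upwards [hfin] with s hs n
    rw [← toReal_enorm]
    exact ENNReal.toReal_mono hs.ne (le_iSup (fun n => ‖f n s‖ₑ) n)
  refine ⟨f, fun s => (⨆ n, ‖f n s‖ₑ).toReal, ⟨hne, hLp, hclosed, hsplice, ?_, ?_⟩, hfm, hfK,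
    hdense, hGm.ennreal_toReal, hfg⟩
  · refine ⟨hGm.ennreal_toReal.aestronglyMeasurable, ?_⟩
    rw [eLpNorm_lt_top_iff_lintegral_rpow_enorm_lt_top hq0 ENNReal.ofReal_ne_top, hqt]
    refine lt_of_le_of_lt (lintegral_mono fun s => ?_) (hG.trans_lt hCp)
    refine ENNReal.rpow_le_rpow ?_ hp0.le
    rw [Real.enorm_of_nonneg ENNReal.toReal_nonneg]
    exact ENNReal.ofReal_toReal_le
  · intro k hk
    filter_upwards [hdense k hk, hfg] with s h1 h2
    refine closure_minimal (t := {x | ‖x‖ ≤ (⨆ n, ‖f n s‖ₑ).toReal}) ?_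
      (isClosed_le continuous_norm continuous_const) h1
    rintro _ ⟨n, rfl⟩
    exact h2 n

end Selection

/-! ### The support function of a set of integrals. -/

namespace IsDecomposableFamily

variable {d : ℕ} {μ : Measure ℝ} [IsFiniteMeasure μ] {p : ℝ}
  {K : Set (ℝ → EuclideanSpace ℝ (Fin d))} {g : ℝ → ℝ}
  {f : ℕ → ℝ → EuclideanSpace ℝ (Fin d)}

theorem integrable_supportFn_range (hK : IsDecomposableFamily μ p K g) (hp : 1 ≤ p)
    (hfm : ∀ n, StronglyMeasurable (f n)) (hfg : ∀ᵐ s ∂μ, ∀ n, ‖f n s‖ ≤ g s)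
    (u : EuclideanSpace ℝ (Fin d)) :
    Integrable (fun s => supportFn (Set.range fun n => f n s) u) μ := by
  have heq : (fun s => supportFn (Set.range fun n => f n s) u) =
      fun s => ⨆ n, inner ℝ u (f n s) := by
    ext s
    rw [supportFn, ← Set.range_comp]
    rfl
  have hm : Measurable fun s => supportFn (Set.range fun n => f n s) u := by
    rw [heq]
    exact Measurable.iSup fun n => (hfm n).measurable.const_inner
  refine ((hK.integrable_bound hp).const_mul ‖u‖).mono' hm.aestronglyMeasurable ?_
  filter_upwards [hfg] with s hs
  have hM : ∀ x ∈ Set.range fun n => f n s, ‖x‖ ≤ g s := by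
    rintro _ ⟨n, rfl⟩
    exact hs n
  rw [Real.norm_eq_abs, abs_le]
  constructor
  · refine le_trans ?_ (inner_le_supportFn hM u (x := f 0 s) ⟨0, rfl⟩)
    have h1 := abs_le.1 (abs_real_inner_le_norm u (f 0 s))
    have h2 : ‖u‖ * ‖f 0 s‖ ≤ ‖u‖ * g s := by
      gcongr
      exact hs 0
    linarith [h1.1]
  · refine supportFn_le (Set.range_nonempty _) fun x hx => (real_inner_le_norm u x).trans ?_
    gcongr
    exact hM x hx

/-- Supremum and integral commute. One inequality is pointwise, by density; for the other, spliced
maximisers of `⟪u, f n⟫` over `n ≤ N` converge to the support function, dominated by `‖u‖ * g`. -/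
theorem supportFn_image_setIntegral (hK : IsDecomposableFamily μ p K g) (hp : 1 ≤ p)
    (hfm : ∀ n, StronglyMeasurable (f n)) (hfK : ∀ n, f n ∈ K)
    (hdense : ∀ k ∈ K, ∀ᵐ s ∂μ, k s ∈ closure (Set.range fun n => f n s))
    (hfg : ∀ᵐ s ∂μ, ∀ n, ‖f n s‖ ≤ g s) (A : Set ℝ) (u : EuclideanSpace ℝ (Fin d)) :
    supportFn ((fun k => ∫ s in A, k s ∂μ) '' K) u =
      ∫ s in A, supportFn (Set.range fun n => f n s) u ∂μ := by
  have hint := (hK.integrable_supportFn_range hp hfm hfg u).restrict (s := A)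
  have hinner : ∀ k ∈ K, Integrable (fun s => inner ℝ u (k s)) (μ.restrict A) := fun k hk =>
    ((hK.integrable hp hk).const_inner u).restrict
  have heq : ∀ k ∈ K, inner ℝ u (∫ s in A, k s ∂μ) = ∫ s in A, inner ℝ u (k s) ∂μ := fun k hk =>
    (integral_inner (hK.integrable hp hk).restrict u).symm
  have hle : ∀ k ∈ K, ∀ᵐ s ∂μ, inner ℝ u (k s) ≤ supportFn (Set.range fun n => f n s) u := by
    intro k hk
    filter_upwards [hdense k hk, hfg] with s h1 h2
    have hM : ∀ x ∈ Set.range fun n => f n s, ‖x‖ ≤ g s := by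
      rintro _ ⟨n, rfl⟩
      exact h2 n
    exact closure_minimal (t := {x | inner ℝ u x ≤ supportFn (Set.range fun n => f n s) u})
      (fun x hx => inner_le_supportFn hM u hx) (isClosed_le (by fun_prop) continuous_const) h1
  have hbd : ∀ x ∈ (fun k => ∫ s in A, k s ∂μ) '' K, ‖x‖ ≤ ∫ s in A, g s ∂μ := by
    rintro _ ⟨k, hk, rfl⟩
    exact hK.norm_setIntegral_le hp hk A
  refine le_antisymm (supportFn_le (hK.nonempty.image _) ?_) ?_
  · rintro _ ⟨k, hk, rfl⟩
    simp only
    rw [heq k hk]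
    exact integral_mono_ae (hinner k hk) hint (ae_restrict_of_ae (hle k hk))
  · choose h hhK hhm hhle using exists_mem_forall_le hK.splice_mem hfm hfK
      (φ := fun x => inner ℝ u x) (by fun_prop)
    have hlim : Tendsto (fun N => ∫ s in A, inner ℝ u (h N s) ∂μ) atTop
        (𝓝 (∫ s in A, supportFn (Set.range fun n => f n s) u ∂μ)) := by
      refine tendsto_integral_of_dominated_convergence (fun s => ‖u‖ * g s)
        (fun N => (hinner _ (hhK N)).1) ((hK.integrable_bound hp).const_mul _).restrict
        (fun N => ae_restrict_of_ae ?_) (ae_restrict_of_ae ?_)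
      · filter_upwards [hK.norm_le _ (hhK N)] with s hs
        rw [Real.norm_eq_abs]
        refine (abs_real_inner_le_norm _ _).trans ?_
        gcongr
      · filter_upwards [ae_all_iff.2 fun N => hle _ (hhK N), hfg] with s h1 h2
        rw [Metric.tendsto_atTop]
        intro ε hε
        have hne : ((fun x => inner ℝ u x) '' Set.range fun n => f n s).Nonempty :=
          ⟨_, _, ⟨0, rfl⟩, rfl⟩
        obtain ⟨_, ⟨_, ⟨n, rfl⟩, rfl⟩, hn⟩ := exists_lt_of_lt_csSup hne
          (show supportFn (Set.range fun n => f n s) u - ε < _ from sub_lt_self _ hε)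
        refine ⟨n, fun N hN => ?_⟩
        rw [Real.dist_eq, abs_lt]
        have h3 := hhle N s n hN
        have h4 := h1 N
        constructor <;> linarith
    refine le_of_tendsto hlim (Eventually.of_forall fun N => ?_)
    rw [← heq _ (hhK N)]
    exact inner_le_supportFn hbd u ⟨_, hhK N, rfl⟩

end IsDecomposableFamily

/-! ### Riesz variation as a monotone function, and absolute continuity. -/

namespace RieszVar

section CumulativeVariation

variable {E : Type*} [PseudoMetricSpace E] {T : ℝ}

/-- The Riesz `p`-variation of `f` on `[0,x]`. -/
noncomputable def cumVariation (p : ℝ) (f : Set.Icc (0 : ℝ) T → E) (x : ℝ) : ℝ≥0∞ :=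
  ⨆ (n : ℕ) (t : Fin (n + 1) → Set.Icc (0 : ℝ) T) (_ : StrictMono t)
    (_ : (t 0 : ℝ) = 0) (_ : (t (Fin.last n) : ℝ) = x),
    ∑ i : Fin n, ENNReal.ofReal
      (dist (f (t i.castSucc)) (f (t i.succ)) ^ p
        / ((t i.succ : ℝ) - (t i.castSucc : ℝ)) ^ (p - 1))

theorem cumVariation_right (p : ℝ) (f : Set.Icc (0 : ℝ) T → E) :
    cumVariation p f T = rieszVariation p f := rfl

/-- Appending `y` to a partition of `[0,x]` gives a partition of `[0,y]`. -/
theorem cumVariation_add_le (p : ℝ) (f : Set.Icc (0 : ℝ) T → E) {x y : Set.Icc (0 : ℝ) T}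
    (hxy : x < y) :
    cumVariation p f x + ENNReal.ofReal (dist (f x) (f y) ^ p / ((y : ℝ) - x) ^ (p - 1)) ≤
      cumVariation p f y := by
  set b := ENNReal.ofReal (dist (f x) (f y) ^ p / ((y : ℝ) - x) ^ (p - 1)) with hb
  have key : ∀ (n : ℕ) (t : Fin (n + 1) → Set.Icc (0 : ℝ) T), StrictMono t → (t 0 : ℝ) = 0 →
      (t (Fin.last n) : ℝ) = x → (∑ i : Fin n, ENNReal.ofReal
      (dist (f (t i.castSucc)) (f (t i.succ)) ^ p
        / ((t i.succ : ℝ) - (t i.castSucc : ℝ)) ^ (p - 1))) + b ≤ cumVariation p f y := by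
    intro n t ht h0 hl
    have hl' : t (Fin.last n) = x := Subtype.ext hl
    let t' : Fin (n + 2) → Set.Icc (0 : ℝ) T := Fin.snoc (α := fun _ => Set.Icc (0 : ℝ) T) t y
    have hc : ∀ i : Fin (n + 1), t' i.castSucc = t i := fun i => Fin.snoc_castSucc ..
    have hlast : t' (Fin.last (n + 1)) = y := Fin.snoc_last ..
    have hmono : StrictMono t' := by
      rw [Fin.strictMono_iff_lt_succ]
      intro i
      refine Fin.lastCases ?_ (fun j => ?_) i
      · rw [hc, Fin.succ_last, hlast, hl']
        exact hxy
      · rw [hc, Fin.succ_castSucc, hc]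
        exact ht j.castSucc_lt_succ
    have h0' : (t' 0 : ℝ) = 0 := by
      rw [← Fin.castSucc_zero, hc, h0]
    refine le_trans (le_of_eq ?_) (le_iSup_of_le (n + 1) (le_iSup_of_le t' (le_iSup_of_le hmono
      (le_iSup_of_le h0' (le_iSup_of_le (by rw [hlast]) le_rfl)))))
    rw [Fin.sum_univ_castSucc]
    simp only [Fin.succ_last, hlast, Fin.succ_castSucc, hc, hl']
    rfl
  -- Needed to move `b` across a truncated subtraction. The case `x = 0` uses the one-point
  -- partition, since `0, x` would not be strictly increasing.
  have hble : b ≤ cumVariation p f y := by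
    have hx0 : (0 : ℝ) ≤ x := x.2.1
    rcases hx0.eq_or_lt with h0 | h0
    · refine le_trans ?_ (key 0 (fun _ => x) (fun i j hij => absurd hij (by lia)) h0.symm rfl)
      simp
    · have hT : (0 : ℝ) ≤ T := hx0.trans x.2.2
      refine le_trans (le_add_self) (key 1 ![⟨0, le_rfl, hT⟩, x] ?_ rfl rfl)
      rw [Fin.strictMono_iff_lt_succ]
      intro i
      fin_cases i
      exact h0
  have hbt : b ≠ ⊤ := ENNReal.ofReal_ne_top
  rw [← ENNReal.le_sub_iff_add_le_right hbt hble]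
  refine iSup_le fun n => iSup_le fun t => iSup_le fun ht => iSup_le fun h0 => iSup_le fun hl => ?_
  rw [ENNReal.le_sub_iff_add_le_right hbt hble]
  exact key n t ht h0 hl

/-- The Riesz variation on `[0,x]` as a real function on the line, constant outside `[0,T]`. -/
noncomputable def cumVar (hT : 0 ≤ T) (p : ℝ) (f : Set.Icc (0 : ℝ) T → E) : ℝ → ℝ :=
  Set.IccExtend hT fun x => (cumVariation p f x).toReal

variable {p : ℝ} {f : Set.Icc (0 : ℝ) T → E}

theorem cumVariation_mono {x y : Set.Icc (0 : ℝ) T} (hxy : x ≤ y) :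
    cumVariation p f x ≤ cumVariation p f y := by
  rcases hxy.eq_or_lt with rfl | h
  · exact le_rfl
  · exact le_self_add.trans (cumVariation_add_le p f h)

theorem cumVariation_lt_top (hf : rieszVariation p f < ⊤) (x : Set.Icc (0 : ℝ) T) :
    cumVariation p f x < ⊤ := by
  have hT : (0 : ℝ) ≤ T := x.2.1.trans x.2.2
  have hx : x ≤ (⟨T, hT, le_rfl⟩ : Set.Icc (0 : ℝ) T) := x.2.2
  refine lt_of_le_of_lt (cumVariation_mono hx) ?_
  rwa [cumVariation_right]

theorem monotone_cumVar (hT : 0 ≤ T) (hf : rieszVariation p f < ⊤) :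
    Monotone (cumVar hT p f) :=
  Monotone.IccExtend hT (f := fun x : Set.Icc (0 : ℝ) T => (cumVariation p f x).toReal)
    fun _ y hxy => ENNReal.toReal_mono (cumVariation_lt_top hf y).ne (cumVariation_mono hxy)

/-- Increments of `f` are controlled by those of a monotone real function, which brings in
Lebesgue's theory of monotone functions. -/
theorem dist_rpow_le_cumVar (hT : 0 ≤ T) (hp : 1 ≤ p) (hf : rieszVariation p f < ⊤) {x y : ℝ}
    (hx : x ∈ Set.Icc 0 T) (hy : y ∈ Set.Icc 0 T) (hxy : x ≤ y) :
    dist (Set.IccExtend hT f x) (Set.IccExtend hT f y) ^ p ≤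
      (cumVar hT p f y - cumVar hT p f x) * (y - x) ^ (p - 1) := by
  rw [cumVar, Set.IccExtend_of_mem _ _ hx, Set.IccExtend_of_mem _ _ hy,
    Set.IccExtend_of_mem _ _ hx, Set.IccExtend_of_mem _ _ hy]
  rcases hxy.eq_or_lt with rfl | hlt
  · rw [dist_self, Real.zero_rpow (by linarith)]
    simp
  have h1 := cumVariation_add_le p f (x := ⟨x, hx⟩) (y := ⟨y, hy⟩) hlt
  have h2 := ENNReal.toReal_mono (cumVariation_lt_top hf ⟨y, hy⟩).ne h1
  have hpos : 0 < (y - x) ^ (p - 1) := Real.rpow_pos_of_pos (sub_pos.2 hlt) _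
  rw [ENNReal.toReal_add (cumVariation_lt_top hf ⟨x, hx⟩).ne ENNReal.ofReal_ne_top,
    ENNReal.toReal_ofReal (div_nonneg (Real.rpow_nonneg dist_nonneg _) hpos.le)] at h2
  rw [← div_le_iff₀ hpos]
  simp only at h2
  linarith

theorem cumVar_sub_le (hT : 0 ≤ T) :
    ENNReal.ofReal (cumVar hT p f T - cumVar hT p f 0) ≤ rieszVariation p f := by
  have h1 : cumVar hT p f T = (rieszVariation p f).toReal := by
    rw [cumVar, Set.IccExtend_right]
    rfl
  have h0 : 0 ≤ cumVar hT p f 0 := ENNReal.toReal_nonneg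
  refine (ENNReal.ofReal_le_ofReal (sub_le_self _ h0)).trans ?_
  rw [h1]
  exact ENNReal.ofReal_toReal_le

end CumulativeVariation

end RieszVar

/-- Induction removing the interval with the largest left endpoint: if it is nondegenerate,
disjointness forces all others to its left. -/
theorem Monotone.sum_sub_le_of_pairwiseDisjoint {ι : Type*} {F : ℝ → ℝ} (hF : Monotone F)
    {a b : ι → ℝ} {x : ℝ} (s : Finset ι) :
    ∀ y, x ≤ y → (∀ i ∈ s, x ≤ a i ∧ a i ≤ b i ∧ b i ≤ y) →
      (s : Set ι).PairwiseDisjoint (fun i => Set.Ioc (a i) (b i)) →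
      ∑ i ∈ s, (F (b i) - F (a i)) ≤ F y - F x := by
  classical
  induction s using Finset.induction_on_max_value a with
  | empty =>
    intro y hxy _ _
    simpa using hF hxy
  | insert i s his hmax ih =>
    intro y hxy hab hdisj
    rw [Finset.sum_insert his]
    obtain ⟨h1, h2, h3⟩ := hab i (Finset.mem_insert_self _ _)
    have hdisj' : (s : Set ι).PairwiseDisjoint (fun i => Set.Ioc (a i) (b i)) :=
      hdisj.subset (by simp)
    rcases h2.eq_or_lt with heq | hlt
    · have := ih y hxy (fun j hj => hab j (Finset.mem_insert_of_mem hj)) hdisj'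
      rw [heq]
      linarith
    · have := ih (a i) h1 (fun j hj => ?_) hdisj'
      · linarith [hF h3]
      · obtain ⟨g1, g2, g3⟩ := hab j (Finset.mem_insert_of_mem hj)
        refine ⟨g1, g2, ?_⟩
        by_contra! hlt'
        have hne : i ≠ j := fun h => his (h ▸ hj)
        have hd := hdisj (by simp) (by simp [hj]) hne
        have h5 : min (b i) (b j) ∈ Set.Ioc (a i) (b i) := ⟨lt_min hlt hlt', min_le_left _ _⟩
        exact Set.disjoint_left.1 hd h5
          ⟨(hmax j hj).trans_lt (lt_min hlt hlt'), min_le_right _ _⟩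

namespace RieszVar

/-- For each `C > 0`, an increment `D` over length `ℓ` satisfies `D ≤ C ℓ + ΔF / C ^ (p - 1)`: if `D
> C ℓ`, put `ℓ < D / C` into `D ^ p ≤ ΔF * ℓ ^ (p - 1)`. Since `p > 1`, a large `C` makes the total
of the second terms small; a short total length then handles the first. -/
theorem absolutelyContinuousOnInterval_of_rieszVariation_lt_top {E : Type*} [PseudoMetricSpace E]
    {T : ℝ} (hT : 0 ≤ T) {p : ℝ} (hp : 1 < p) {f : Set.Icc (0 : ℝ) T → E}
    (hf : rieszVariation p f < ⊤) : AbsolutelyContinuousOnInterval (Set.IccExtend hT f) 0 T := by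
  set h := Set.IccExtend hT f with hh
  set F := cumVar hT p f with hFdef
  have hF : Monotone F := monotone_cumVar hT hf
  have hstep : ∀ C : ℝ, 0 < C → ∀ x ∈ Set.Icc 0 T, ∀ y ∈ Set.Icc 0 T, x ≤ y →
      dist (h x) (h y) ≤ C * (y - x) + (F y - F x) / C ^ (p - 1) := by
    intro C hC x hx y hy hxy
    have h1 := dist_rpow_le_cumVar hT hp.le hf hx hy hxy
    have hΔF : 0 ≤ F y - F x := sub_nonneg.2 (hF hxy)
    have hCp : 0 < C ^ (p - 1) := Real.rpow_pos_of_pos hC _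
    rcases le_or_gt (dist (h x) (h y)) (C * (y - x)) with hle | hlt
    · exact hle.trans (le_add_of_nonneg_right (by positivity))
    · have hD : 0 < dist (h x) (h y) := (mul_nonneg hC.le (sub_nonneg.2 hxy)).trans_lt hlt
      have h2 : (y - x) ^ (p - 1) ≤ dist (h x) (h y) ^ (p - 1) / C ^ (p - 1) := by
        rw [← Real.div_rpow hD.le hC.le]
        refine Real.rpow_le_rpow (sub_nonneg.2 hxy) ?_ (by linarith)
        rw [le_div_iff₀ hC, mul_comm]
        exact hlt.le
      have h3 : dist (h x) (h y) ^ p = dist (h x) (h y) * dist (h x) (h y) ^ (p - 1) := by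
        rw [← Real.rpow_one_add' hD.le (by linarith)]
        congr 1
        ring
      have hDp : 0 < dist (h x) (h y) ^ (p - 1) := Real.rpow_pos_of_pos hD _
      have h4 : dist (h x) (h y) * dist (h x) (h y) ^ (p - 1) ≤
          (F y - F x) / C ^ (p - 1) * dist (h x) (h y) ^ (p - 1) := by
        rw [← h3]
        refine h1.trans ((mul_le_mul_of_nonneg_left h2 hΔF).trans (le_of_eq ?_))
        ring
      have h5 := le_of_mul_le_mul_right h4 hDp
      have h6 : 0 ≤ C * (y - x) := mul_nonneg hC.le (sub_nonneg.2 hxy)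
      linarith
  rw [absolutelyContinuousOnInterval_iff]
  intro ε hε
  have hFT : 0 ≤ F T - F 0 := sub_nonneg.2 (hF hT)
  obtain ⟨C, hC, hCε⟩ : ∃ C : ℝ, 0 < C ∧ (F T - F 0) / C ^ (p - 1) < ε / 2 := by
    have ht : Tendsto (fun C : ℝ => (F T - F 0) / C ^ (p - 1)) atTop (𝓝 0) :=
      (tendsto_rpow_atTop (by linarith)).const_div_atTop _
    exact ((eventually_gt_atTop 0).and (ht.eventually_lt_const (half_pos hε))).exists
  refine ⟨ε / (2 * C), by positivity, fun I hI hlen => ?_⟩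
  obtain ⟨hmem, hdisj⟩ := hI
  rw [Set.uIcc_of_le hT] at hmem
  have hterm : ∀ i ∈ Finset.range I.1, dist (h (I.2 i).1) (h (I.2 i).2) ≤
      C * dist (I.2 i).1 (I.2 i).2 +
        (F (max (I.2 i).1 (I.2 i).2) - F (min (I.2 i).1 (I.2 i).2)) / C ^ (p - 1) := by
    intro i hi
    obtain ⟨m1, m2⟩ := hmem i hi
    rcases le_total (I.2 i).1 (I.2 i).2 with hle | hle
    · rw [max_eq_right hle, min_eq_left hle, Real.dist_eq, abs_sub_comm, abs_of_nonneg (by linarith)]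
      exact hstep C hC _ m1 _ m2 hle
    · rw [max_eq_left hle, min_eq_right hle, Real.dist_eq, abs_of_nonneg (by linarith), dist_comm]
      exact hstep C hC _ m2 _ m1 hle
  have hsum := hF.sum_sub_le_of_pairwiseDisjoint (a := fun i => min (I.2 i).1 (I.2 i).2)
    (b := fun i => max (I.2 i).1 (I.2 i).2) (x := 0) (Finset.range I.1) T hT (fun i hi => by
      obtain ⟨m1, m2⟩ := hmem i hi
      exact ⟨le_min m1.1 m2.1, min_le_max, max_le m1.2 m2.2⟩) hdisj
  refine (Finset.sum_le_sum hterm).trans_lt ?_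
  rw [Finset.sum_add_distrib, ← Finset.mul_sum, ← Finset.sum_div]
  have hCp : 0 < C ^ (p - 1) := Real.rpow_pos_of_pos hC _
  have h1 : C * ∑ i ∈ Finset.range I.1, dist (I.2 i).1 (I.2 i).2 < ε / 2 := by
    have := mul_lt_mul_of_pos_left hlen hC
    have h2 : C * (ε / (2 * C)) = ε / 2 := by field_simp
    linarith
  have h3 := div_le_div_of_nonneg_right hsum hCp.le
  linarith

end RieszVar

/-! ### The fundamental theorem of calculus in Euclidean space, coordinate by coordinate. -/

namespace AbsolutelyContinuousOnInterval

variable {d : ℕ} {a b : ℝ} {f : ℝ → EuclideanSpace ℝ (Fin d)}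

theorem euclidean_apply (hf : AbsolutelyContinuousOnInterval f a b) (i : Fin d) :
    AbsolutelyContinuousOnInterval (fun x => f x i) a b := by
  refine squeeze_zero (fun _ => Finset.sum_nonneg fun _ _ => dist_nonneg) (fun E => ?_) hf
  refine Finset.sum_le_sum fun j _ => ?_
  rw [dist_eq_norm, dist_eq_norm]
  exact PiLp.norm_apply_le (f (E.2 j).1 - f (E.2 j).2) i

theorem ae_differentiableAt_euclidean (hf : AbsolutelyContinuousOnInterval f a b) :
    ∀ᵐ x, x ∈ Set.uIcc a b → DifferentiableAt ℝ f x :=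
  hf.boundedVariationOn.ae_differentiableAt_of_mem_uIcc

theorem ae_deriv_apply (hf : AbsolutelyContinuousOnInterval f a b) (i : Fin d) :
    ∀ᵐ x, x ∈ Set.uIcc a b → deriv (fun x => f x i) x = deriv f x i := by
  filter_upwards [hf.ae_differentiableAt_euclidean] with x hx hxab
  exact ((EuclideanSpace.proj i : EuclideanSpace ℝ (Fin d) →L[ℝ] ℝ).hasFDerivAt.comp_hasDerivAt x
    (hx hxab).hasDerivAt).deriv

theorem intervalIntegrable_deriv_euclidean (hf : AbsolutelyContinuousOnInterval f a b) :
    IntervalIntegrable (deriv f) volume a b := by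
  have hsum : IntervalIntegrable (fun x => ∑ i, |deriv (fun x => f x i) x|) volume a b := by
    have := IntervalIntegrable.sum Finset.univ (f := fun (i : Fin d) x => |deriv (fun x => f x i) x|)
      fun i _ => (hf.euclidean_apply i).intervalIntegrable_deriv.abs
    convert! this using 1
    ext x
    simp
  refine hsum.mono_fun (aestronglyMeasurable_deriv f _) ?_
  have h := ae_all_iff.2 fun i => hf.ae_deriv_apply i
  refine (ae_restrict_iff' measurableSet_uIoc).2 ?_
  filter_upwards [h] with x hx hxab
  rw [Real.norm_of_nonneg (Finset.sum_nonneg fun _ _ => abs_nonneg _), EuclideanSpace.norm_eq,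
    Real.sqrt_le_left (Finset.sum_nonneg fun _ _ => abs_nonneg _)]
  have h1 : ∀ i, |deriv (fun x => f x i) x| = ‖deriv f x i‖ := fun i => by
    rw [hx i (Set.uIoc_subset_uIcc hxab), Real.norm_eq_abs]
  simp only [h1]
  exact Finset.sum_sq_le_sq_sum_of_nonneg fun _ _ => norm_nonneg _

theorem integral_deriv_eq_sub_euclidean (hf : AbsolutelyContinuousOnInterval f a b) :
    ∫ x in a..b, deriv f x = f b - f a := by
  ext i
  have h1 := (EuclideanSpace.proj i :
    EuclideanSpace ℝ (Fin d) →L[ℝ] ℝ).intervalIntegral_comp_comm hf.intervalIntegrable_deriv_euclidean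
  have h2 := (hf.euclidean_apply i).integral_deriv_eq_sub
  have h3 : ∫ x in a..b, deriv (fun x => f x i) x = ∫ x in a..b, deriv f x i := by
    refine intervalIntegral.integral_congr_ae ?_
    filter_upwards [hf.ae_deriv_apply i] with x hx hxab
    exact hx (Set.uIoc_subset_uIcc hxab)
  rw [h3] at h2
  exact h1.symm.trans h2

end AbsolutelyContinuousOnInterval

/-! ### Riesz variation against the `L^p` norm of the derivative. -/

namespace RieszVar

/-- The derivative of a function of finite Riesz `p`-variation has `p`-th moment at most the
variation. -/
theorem lintegral_enorm_derivIcc_rpow_le {E : Type*} [NormedAddCommGroup E] [NormedSpace ℝ E]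
    {T p : ℝ} (hT : 0 ≤ T) (hp : 1 ≤ p) {f : Set.Icc (0 : ℝ) T → E}
    (hf : rieszVariation p f < ⊤)
    (hdiff : ∀ᵐ x, x ∈ Set.uIcc 0 T → DifferentiableAt ℝ (Set.IccExtend hT f) x) :
    ∫⁻ s in Set.Ioc 0 T, ‖derivIcc hT f s‖ₑ ^ p ≤ rieszVariation p f := by
  have hp0 : 0 < p := by linarith
  set F := cumVar hT p f
  have hF : Monotone F := monotone_cumVar hT hf
  -- Divide `dist_rpow_le_cumVar` by `(y - x) ^ p` and let `y` decrease to `x`. The integral of `F'`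
  -- is then at most `F T - F 0`, as for any monotone function.
  have hpt : ∀ᵐ x ∂(volume.restrict (Set.Ioc 0 T)), ‖derivIcc hT f x‖ ^ p ≤ deriv F x := by
    rw [← restrict_Ioo_eq_restrict_Ioc]
    refine (ae_restrict_iff' measurableSet_Ioo).2 ?_
    filter_upwards [hdiff, hF.ae_differentiableAt] with x hx hxF hxT
    have hd := (hx (by rw [Set.uIcc_of_le hT]; exact Set.Ioo_subset_Icc_self hxT)).hasDerivAt
    have hright : Tendsto (slope (Set.IccExtend hT f) x) (𝓝[>] x) (𝓝 (derivIcc hT f x)) :=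
      (hasDerivAt_iff_tendsto_slope.1 hd).mono_left
        (nhdsWithin_mono _ fun y hy => ne_of_gt hy)
    have hrightF : Tendsto (slope F x) (𝓝[>] x) (𝓝 (deriv F x)) :=
      (hasDerivAt_iff_tendsto_slope.1 hxF.hasDerivAt).mono_left
        (nhdsWithin_mono _ fun y hy => ne_of_gt hy)
    refine le_of_tendsto_of_tendsto (hright.norm.rpow_const (Or.inr hp0.le)) hrightF ?_
    filter_upwards [Ioo_mem_nhdsGT hxT.2] with y hy
    have h1 := dist_rpow_le_cumVar hT hp hf (Set.Ioo_subset_Icc_self hxT)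
      ⟨hxT.1.le.trans hy.1.le, hy.2.le⟩ hy.1.le
    have hpos : 0 < y - x := sub_pos.2 hy.1
    rw [slope_def_module, slope_def_field, norm_smul, norm_inv, Real.norm_of_nonneg hpos.le,
      Real.mul_rpow (inv_nonneg.2 hpos.le) (norm_nonneg _), Real.inv_rpow hpos.le,
      inv_mul_le_iff₀ (Real.rpow_pos_of_pos hpos _), ← dist_eq_norm, dist_comm]
    refine h1.trans (le_of_eq ?_)
    rw [Real.rpow_sub_one hpos.ne']
    ring
  have hint := hF.monotoneOn (Set.uIcc 0 T) |>.intervalIntegrable_deriv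
  rw [intervalIntegrable_iff_integrableOn_Ioc_of_le hT] at hint
  have hle := (hF.monotoneOn (Set.uIcc 0 T)).intervalIntegral_deriv_mem_uIcc
  rw [Set.uIcc_of_le (sub_nonneg.2 (hF hT)), intervalIntegral.integral_of_le hT] at hle
  calc ∫⁻ s in Set.Ioc 0 T, ‖derivIcc hT f s‖ₑ ^ p
      ≤ ∫⁻ s in Set.Ioc 0 T, ENNReal.ofReal (deriv F s) := by
        refine lintegral_mono_ae (hpt.mono fun s hs => ?_)
        rw [← ofReal_norm, ENNReal.ofReal_rpow_of_nonneg (norm_nonneg _) hp0.le]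
        exact ENNReal.ofReal_le_ofReal hs
    _ = ENNReal.ofReal (∫ s in Set.Ioc 0 T, deriv F s) :=
        (ofReal_integral_eq_lintegral_ofReal hint (hpt.mono fun s hs =>
          (Real.rpow_nonneg (norm_nonneg _) _).trans hs)).symm
    _ ≤ ENNReal.ofReal (F T - F 0) := ENNReal.ofReal_le_ofReal hle.2
    _ ≤ rieszVariation p f := cumVar_sub_le hT

/-- The primitive `t ↦ x₀ + ∫₀ᵗ k`. -/
noncomputable def primitive {E : Type*} [NormedAddCommGroup E] [NormedSpace ℝ E] {T : ℝ} (x₀ : E)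
    (k : ℝ → E) : Set.Icc (0 : ℝ) T → E :=
  fun t => x₀ + ∫ s in (0 : ℝ)..t, k s

theorem enorm_integral_rpow_le {E : Type*} [NormedAddCommGroup E] [NormedSpace ℝ E] {p : ℝ}
    (hp : 1 ≤ p) {k : ℝ → E} {A : Set ℝ} (hk : AEStronglyMeasurable k (volume.restrict A)) :
    ‖∫ s in A, k s‖ₑ ≤ eLpNorm k (ENNReal.ofReal p) (volume.restrict A) *
      (volume A) ^ (1 - 1 / p) := by
  have hp0 : 0 < p := by linarith
  refine (enorm_integral_le_lintegral_enorm _).trans ?_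
  rw [← eLpNorm_one_eq_lintegral_enorm]
  refine (eLpNorm_le_eLpNorm_mul_rpow_measure_univ (q := ENNReal.ofReal p) (by simpa using hp)
    hk).trans (le_of_eq ?_)
  rw [ENNReal.toReal_ofReal hp0.le, Measure.restrict_apply_univ]
  simp

theorem ofReal_norm_integral_div_le {E : Type*} [NormedAddCommGroup E] [NormedSpace ℝ E] {p : ℝ}
    (hp : 1 ≤ p) {k : ℝ → E} {a b : ℝ} (hab : a < b)
    (hk : AEStronglyMeasurable k (volume.restrict (Set.Ioc a b))) :
    ENNReal.ofReal (‖∫ s in a..b, k s‖ ^ p / (b - a) ^ (p - 1)) ≤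
      ∫⁻ s in Set.Ioc a b, ‖k s‖ₑ ^ p := by
  have hp0 : 0 < p := by linarith
  have hpos : 0 < b - a := sub_pos.2 hab
  have h1 := ENNReal.rpow_le_rpow (enorm_integral_rpow_le hp hk) hp0.le
  rw [ENNReal.mul_rpow_of_nonneg _ _ hp0.le, ← ENNReal.rpow_mul, Real.volume_Ioc,
    eLpNorm_eq_lintegral_rpow_enorm_toReal (by simpa using hp0) ENNReal.ofReal_ne_top,
    ENNReal.toReal_ofReal hp0.le, ← ENNReal.rpow_mul, one_div_mul_cancel hp0.ne',
    ENNReal.rpow_one, sub_mul, one_div_mul_cancel hp0.ne', one_mul] at h1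
  rw [intervalIntegral.integral_of_le hab.le, ENNReal.ofReal_div_of_pos (Real.rpow_pos_of_pos hpos _),
    ← ENNReal.ofReal_rpow_of_nonneg (norm_nonneg _) hp0.le, ofReal_norm,
    ← ENNReal.ofReal_rpow_of_pos hpos]
  refine ENNReal.div_le_of_le_mul ?_
  exact h1

theorem rieszVariation_primitive_le {E : Type*} [NormedAddCommGroup E] [NormedSpace ℝ E] {T p : ℝ}
    (hp : 1 ≤ p) (x₀ : E) {k : ℝ → E} (hk : IntegrableOn k (Set.Ioc 0 T)) :
    rieszVariation p (primitive (T := T) x₀ k) ≤ ∫⁻ s in Set.Ioc 0 T, ‖k s‖ₑ ^ p := by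
  refine iSup_le fun n => iSup_le fun t => iSup_le fun ht => iSup_le fun h0 => iSup_le fun hl => ?_
  have hsub : ∀ i : Fin n, Set.Ioc (t i.castSucc : ℝ) (t i.succ) ⊆ Set.Ioc 0 T := fun i =>
    Set.Ioc_subset_Ioc (t _).2.1 (t _).2.2
  have hint : ∀ x : Set.Icc (0 : ℝ) T, IntervalIntegrable k volume 0 x := fun x =>
    (intervalIntegrable_iff_integrableOn_Ioc_of_le x.2.1).2
      (hk.mono_set (Set.Ioc_subset_Ioc_right x.2.2))
  -- By Hölder each term of the variation is at most the `κ`-mass of its own interval, and these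
  -- intervals are disjoint.
  let κ := (volume.restrict (Set.Ioc 0 T)).withDensity fun s => ‖k s‖ₑ ^ p
  have hterm : ∀ i : Fin n, ENNReal.ofReal
      (dist (primitive x₀ k (t i.castSucc)) (primitive x₀ k (t i.succ)) ^ p
        / ((t i.succ : ℝ) - (t i.castSucc : ℝ)) ^ (p - 1)) ≤
      κ (Set.Ioc (t i.castSucc : ℝ) (t i.succ)) := by
    intro i
    have hlt : (t i.castSucc : ℝ) < t i.succ := ht i.castSucc_lt_succ
    rw [withDensity_apply _ measurableSet_Ioc, Measure.restrict_restrict measurableSet_Ioc,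
      Set.inter_eq_left.2 (hsub i), dist_comm, dist_eq_norm]
    have : primitive x₀ k (t i.succ) - primitive x₀ k (t i.castSucc) =
        ∫ s in (t i.castSucc : ℝ)..(t i.succ), k s := by
      rw [← intervalIntegral.integral_interval_sub_left (hint _) (hint _)]
      simp [primitive]
    rw [this]
    exact ofReal_norm_integral_div_le hp hlt (hk.mono_set (hsub i)).1
  refine (Finset.sum_le_sum fun i _ => hterm i).trans ?_
  rw [← setLIntegral_univ (μ := volume.restrict (Set.Ioc 0 T)),
    ← withDensity_apply _ MeasurableSet.univ]
  refine sum_measure_le_measure_univ (fun i _ => measurableSet_Ioc.nullMeasurableSet) ?_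
  have hlt : ∀ i j : Fin n, i < j → Disjoint (Set.Ioc (t i.castSucc : ℝ) (t i.succ))
      (Set.Ioc (t j.castSucc : ℝ) (t j.succ)) := by
    intro i j hij
    rw [Set.Ioc_disjoint_Ioc]
    have h1 : (t i.succ : ℝ) ≤ t j.castSucc := ht.monotone (by
      rw [Fin.le_def]
      simp only [Fin.val_succ, Fin.val_castSucc]
      exact hij)
    exact (min_le_left _ _).trans (h1.trans (le_max_right _ _))
  intro i _ j _ hij
  refine Disjoint.aedisjoint ?_
  rcases lt_or_gt_of_ne hij with h | h
  · exact hlt i j h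
  · exact (hlt j i h).symm

/-- Integration is continuous from `L^p` to `BV_p`; this transfers closedness of `R` to its
densities. -/
theorem vpNorm_primitive_zero_le {E : Type*} [NormedAddCommGroup E] [NormedSpace ℝ E] {T p : ℝ}
    (hp : 1 ≤ p) {k : ℝ → E}
    (hk : MemLp k (ENNReal.ofReal p) (volume.restrict (Set.Ioc 0 T))) :
    vpNorm p (primitive (T := T) 0 k) ≤ (ENNReal.ofReal T ^ (1 - 1 / p) + 1) *
      eLpNorm k (ENNReal.ofReal p) (volume.restrict (Set.Ioc 0 T)) := by
  have hp0 : 0 < p := by linarith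
  have hint : IntegrableOn k (Set.Ioc 0 T) := hk.integrable (by simpa using hp)
  rw [add_mul, one_mul, vpNorm]
  refine add_le_add (iSup_le fun t => ?_) ?_
  · have hsub : Set.Ioc 0 (t : ℝ) ⊆ Set.Ioc 0 T := Set.Ioc_subset_Ioc_right t.2.2
    rw [primitive, zero_add, intervalIntegral.integral_of_le t.2.1, mul_comm]
    refine (enorm_integral_rpow_le hp (hint.mono_set hsub).1).trans ?_
    refine mul_le_mul' (eLpNorm_mono_measure _ (Measure.restrict_mono hsub le_rfl)) ?_
    refine ENNReal.rpow_le_rpow ?_ ?_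
    · rw [Real.volume_Ioc, sub_zero]
      exact ENNReal.ofReal_le_ofReal t.2.2
    · rw [sub_nonneg, div_le_one hp0]
      exact hp
  · rw [eLpNorm_eq_lintegral_rpow_enorm_toReal (by simpa using hp0) ENNReal.ofReal_ne_top,
      ENNReal.toReal_ofReal hp0.le]
    exact ENNReal.rpow_le_rpow (rieszVariation_primitive_le hp 0 hint) (by positivity)

end RieszVar

/-! ### From half-lines to all measurable sets. -/

section Splice

/-- A closed family of `p`-integrable functions on the line that is stable under splicing along
half-lines is stable under splicing along all measurable sets. -/
theorem splice_mem_of_forall_Iio {E : Type*} [NormedAddCommGroup E] {μ : Measure ℝ} {p : ℝ}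
    (hp : 1 ≤ p) {K : Set (ℝ → E)} (hLp : ∀ k ∈ K, MemLp k (ENNReal.ofReal p) μ)
    (hclosed : ∀ u : ℕ → ℝ → E, (∀ n, u n ∈ K) → ∀ k, MemLp k (ENNReal.ofReal p) μ →
      Tendsto (fun n => eLpNorm (u n - k) (ENNReal.ofReal p) μ) atTop (𝓝 0) → k ∈ K)
    (hIio : ∀ a, ∀ k₁ ∈ K, ∀ k₂ ∈ K, splice (Set.Iio a) k₁ k₂ ∈ K) (B : Set ℝ)
    (hB : MeasurableSet B) : ∀ k₁ ∈ K, ∀ k₂ ∈ K, splice B k₁ k₂ ∈ K := by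
  have hgen : MeasurableSet[MeasurableSpace.generateFrom (Set.range Set.Iio)] B := by
    rw [← borel_eq_generateFrom_Iio, ← BorelSpace.measurable_eq]
    exact hB
  have hsup : ∀ (B B' : Set ℝ) (k₁ k₂ : ℝ → E),
      splice (B ∪ B') k₁ k₂ = splice B k₁ (splice B' k₁ k₂) := by
    intro B B' k₁ k₂
    ext s
    by_cases h : s ∈ B <;> by_cases h' : s ∈ B' <;> simp [splice, h, h']
  suffices H : MeasurableSet B ∧ ∀ k₁ ∈ K, ∀ k₂ ∈ K, splice B k₁ k₂ ∈ K from H.2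
  clear hB
  -- Half-lines generate the Borel sets. A complement swaps the two functions, a finite union is an
  -- iterated splice, and a countable union is a limit dominated by `‖k₁‖ + ‖k₂‖`.
  induction B, hgen using MeasurableSpace.generateFrom_induction with
  | hC t ht =>
    obtain ⟨a, rfl⟩ := ht
    exact ⟨measurableSet_Iio, hIio a⟩
  | empty =>
    refine ⟨MeasurableSet.empty, fun k₁ _ k₂ h₂ => ?_⟩
    have : splice ∅ k₁ k₂ = k₂ := by
      ext s
      simp [splice]
    rwa [this]
  | compl t _ ih =>
    refine ⟨ih.1.compl, fun k₁ h₁ k₂ h₂ => ?_⟩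
    have : splice tᶜ k₁ k₂ = splice t k₂ k₁ := by
      ext s
      by_cases h : s ∈ t <;> simp [splice, h]
    rw [this]
    exact ih.2 k₂ h₂ k₁ h₁
  | iUnion t _ ih =>
    have hm : MeasurableSet (⋃ n, t n) := MeasurableSet.iUnion fun n => (ih n).1
    refine ⟨hm, fun k₁ h₁ k₂ h₂ => ?_⟩
    have hacc : ∀ N, splice (Set.accumulate t N) k₁ k₂ ∈ K := by
      intro N
      induction N with
      | zero =>
        have : Set.accumulate t 0 = t 0 := by
          ext s
          simp
        rw [this]
        exact (ih 0).2 _ h₁ _ h₂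
      | succ N ihN =>
        rw [Set.accumulate_succ, Set.union_comm, hsup]
        exact (ih _).2 _ h₁ _ ihN
    have hlim : ∀ s, Tendsto (fun N => splice (Set.accumulate t N) k₁ k₂ s) atTop
        (𝓝 (splice (⋃ n, t n) k₁ k₂ s)) := by
      intro s
      by_cases hs : s ∈ ⋃ n, t n
      · obtain ⟨n, hn⟩ := Set.mem_iUnion.1 hs
        refine tendsto_const_nhds.congr' ?_
        filter_upwards [eventually_ge_atTop n] with N hN
        rw [splice_of_mem hs, splice_of_mem (Set.mem_accumulate.2 ⟨n, hN, hn⟩)]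
      · refine tendsto_const_nhds.congr fun N => ?_
        rw [splice_of_notMem hs, splice_of_notMem]
        intro h
        obtain ⟨n, _, hn⟩ := Set.mem_accumulate.1 h
        exact hs (Set.mem_iUnion.2 ⟨n, hn⟩)
    obtain ⟨m1, m2⟩ := tendsto_eLpNorm_sub_of_dominated hp (fun N => (hLp _ (hacc N)).1)
      ((hLp k₁ h₁).norm.add (hLp k₂ h₂).norm) (fun N => ae_of_all _ fun s => by
        by_cases hs : s ∈ Set.accumulate t N
        · rw [splice_of_mem hs]
          simp
        · rw [splice_of_notMem hs]
          simp) (ae_of_all _ hlim)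
    exact hclosed _ hacc _ m1 m2

end Splice

/-! ### The densities of `R` form a closed, bounded, decomposable family. -/

namespace RieszVar

section Family

variable {d : ℕ} {T p : ℝ}

/-- The `p`-integrable functions whose primitive starting at `x₀` belongs to `R`. -/
def densities (p : ℝ) (x₀ : EuclideanSpace ℝ (Fin d))
    (R : Set (Set.Icc (0 : ℝ) T → EuclideanSpace ℝ (Fin d))) :
    Set (ℝ → EuclideanSpace ℝ (Fin d)) :=
  {k | MemLp k (ENNReal.ofReal p) (volume.restrict (Set.Ioc 0 T)) ∧ primitive x₀ k ∈ R}

theorem primitive_congr {x₀ : EuclideanSpace ℝ (Fin d)} {k k' : ℝ → EuclideanSpace ℝ (Fin d)}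
    (h : k =ᵐ[volume.restrict (Set.Ioc 0 T)] k') :
    primitive (T := T) x₀ k = primitive x₀ k' := by
  ext1 t
  rw [primitive, primitive, intervalIntegral.integral_of_le t.2.1,
    intervalIntegral.integral_of_le t.2.1]
  congr 1
  exact integral_congr_ae (ae_restrict_of_ae_restrict_of_subset
    (Set.Ioc_subset_Ioc_right t.2.2) h)

theorem derivIcc_primitive_ae_eq (hT : 0 ≤ T) (x₀ : EuclideanSpace ℝ (Fin d))
    {k : ℝ → EuclideanSpace ℝ (Fin d)} (hk : IntegrableOn k (Set.Ioc 0 T)) :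
    derivIcc hT (primitive x₀ k) =ᵐ[volume.restrict (Set.Ioc 0 T)] k := by
  rw [← restrict_Ioo_eq_restrict_Ioc]
  refine (ae_restrict_iff' measurableSet_Ioo).2 ?_
  have hint : IntervalIntegrable k volume 0 T :=
    (intervalIntegrable_iff_integrableOn_Ioc_of_le hT).2 hk
  filter_upwards [hint.ae_hasDerivAt_integral] with x hx hxT
  have h1 := (hx (by rw [Set.uIcc_of_le hT]; exact Set.Ioo_subset_Icc_self hxT) 0
    Set.left_mem_uIcc).const_add x₀
  refine HasDerivAt.deriv (h1.congr_of_eventuallyEq ?_)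
  filter_upwards [Icc_mem_nhds hxT.1 hxT.2] with y hy
  rw [Set.IccExtend_of_mem _ _ hy, primitive]

theorem mem_densities_of_mem (hT : 0 ≤ T) (hp : 1 ≤ p) {x₀ : EuclideanSpace ℝ (Fin d)}
    {R : Set (Set.Icc (0 : ℝ) T → EuclideanSpace ℝ (Fin d))}
    {f : Set.Icc (0 : ℝ) T → EuclideanSpace ℝ (Fin d)} (hfR : f ∈ R)
    (hf : rieszVariation p f < ⊤)
    (hAC : AbsolutelyContinuousOnInterval (Set.IccExtend hT f) 0 T)
    (hf0 : f ⟨0, Set.left_mem_Icc.2 hT⟩ = x₀) :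
    derivIcc hT f ∈ densities p x₀ R ∧ primitive x₀ (derivIcc hT f) = f := by
  have hp0 : 0 < p := by linarith
  have hprim : primitive x₀ (derivIcc hT f) = f := by
    ext1 t
    have h1 := (hAC.mono (c := 0) (d := t) (by
      rw [Set.uIcc_of_le hT, Set.uIcc_of_le t.2.1]
      exact Set.Icc_subset_Icc_right t.2.2)).integral_deriv_eq_sub_euclidean
    rw [Set.IccExtend_of_mem _ _ t.2, Set.IccExtend_of_mem _ _ (Set.left_mem_Icc.2 hT), hf0] at h1
    rw [primitive, derivIcc, h1, add_sub_cancel]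
  refine ⟨⟨⟨aestronglyMeasurable_deriv _ _, ?_⟩, by rwa [hprim]⟩, hprim⟩
  rw [eLpNorm_lt_top_iff_lintegral_rpow_enorm_lt_top (by simpa using hp0) ENNReal.ofReal_ne_top,
    ENNReal.toReal_ofReal hp0.le]
  exact (lintegral_enorm_derivIcc_rpow_le hT hp hf hAC.ae_differentiableAt_euclidean).trans_lt hf

theorem eLpNorm_le_of_mem_densities (hT : 0 ≤ T) (hp : 1 ≤ p) {x₀ : EuclideanSpace ℝ (Fin d)}
    {R : Set (Set.Icc (0 : ℝ) T → EuclideanSpace ℝ (Fin d))}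
    (hAC : ∀ f ∈ R, AbsolutelyContinuousOnInterval (Set.IccExtend hT f) 0 T) (hBV : R ⊆ BV _ T p)
    {C : ℝ≥0∞} (hC : ∀ f ∈ R, vpNorm p f ≤ C) {k : ℝ → EuclideanSpace ℝ (Fin d)}
    (hk : k ∈ densities p x₀ R) :
    eLpNorm k (ENNReal.ofReal p) (volume.restrict (Set.Ioc 0 T)) ≤ C := by
  have hp0 : 0 < p := by linarith
  have hint : IntegrableOn k (Set.Ioc 0 T) := hk.1.integrable (by simpa using hp)
  rw [eLpNorm_congr_ae (derivIcc_primitive_ae_eq hT x₀ hint).symm,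
    eLpNorm_eq_lintegral_rpow_enorm_toReal (by simpa using hp0) ENNReal.ofReal_ne_top,
    ENNReal.toReal_ofReal hp0.le]
  refine le_trans ?_ (hC _ hk.2)
  refine le_trans ?_ (le_add_self)
  exact ENNReal.rpow_le_rpow (lintegral_enorm_derivIcc_rpow_le hT hp (hBV hk.2)
    (hAC _ hk.2).ae_differentiableAt_euclidean) (by positivity)

theorem mem_densities_of_tendsto (hp : 1 ≤ p) {x₀ : EuclideanSpace ℝ (Fin d)}
    {R : Set (Set.Icc (0 : ℝ) T → EuclideanSpace ℝ (Fin d))} (hclosed : IsVpClosed p R)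
    (u : ℕ → ℝ → EuclideanSpace ℝ (Fin d)) (hu : ∀ n, u n ∈ densities p x₀ R)
    (k : ℝ → EuclideanSpace ℝ (Fin d))
    (hk : MemLp k (ENNReal.ofReal p) (volume.restrict (Set.Ioc 0 T)))
    (hlim : Tendsto (fun n => eLpNorm (u n - k) (ENNReal.ofReal p)
      (volume.restrict (Set.Ioc 0 T))) atTop (𝓝 0)) : k ∈ densities p x₀ R := by
  have hp0 : 0 < p := by linarith
  have hint : ∀ {w : ℝ → EuclideanSpace ℝ (Fin d)},
      MemLp w (ENNReal.ofReal p) (volume.restrict (Set.Ioc 0 T)) →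
      IntegrableOn w (Set.Ioc 0 T) := fun hw => hw.integrable (by simpa using hp)
  have hintv : ∀ {w : ℝ → EuclideanSpace ℝ (Fin d)},
      MemLp w (ENNReal.ofReal p) (volume.restrict (Set.Ioc 0 T)) → ∀ t : Set.Icc (0 : ℝ) T,
      IntervalIntegrable w volume 0 t := fun hw t =>
    (intervalIntegrable_iff_integrableOn_Ioc_of_le t.2.1).2
      ((hint hw).mono_set (Set.Ioc_subset_Ioc_right t.2.2))
  refine ⟨hk, hclosed _ ?_ fun ε hε => ?_⟩
  · refine (rieszVariation_primitive_le hp x₀ (hint hk)).trans_lt ?_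
    have := hk.2
    rwa [eLpNorm_lt_top_iff_lintegral_rpow_enorm_lt_top (by simpa using hp0)
      ENNReal.ofReal_ne_top, ENNReal.toReal_ofReal hp0.le] at this
  · set c : ℝ≥0∞ := ENNReal.ofReal T ^ (1 - 1 / p) + 1 with hc
    have hexp : 0 ≤ 1 - 1 / p := by
      rw [sub_nonneg, div_le_one hp0]
      exact hp
    have hct : c ≠ ⊤ := ENNReal.add_ne_top.2
      ⟨ENNReal.rpow_ne_top_of_nonneg hexp ENNReal.ofReal_ne_top, ENNReal.one_ne_top⟩
    have h1 : Tendsto (fun n => c * eLpNorm (u n - k) (ENNReal.ofReal p)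
        (volume.restrict (Set.Ioc 0 T))) atTop (𝓝 0) := by
      have := ENNReal.Tendsto.const_mul hlim (Or.inr hct)
      rwa [mul_zero] at this
    obtain ⟨n, hn⟩ := (h1.eventually_lt_const hε).exists
    refine ⟨primitive x₀ (u n), (hu n).2, lt_of_le_of_lt ?_ hn⟩
    have h2 : primitive (T := T) x₀ k - primitive x₀ (u n) = primitive 0 (k - u n) := by
      ext1 t
      have h3 := intervalIntegral.integral_sub (hintv hk t) (hintv (hu n).1 t)
      simp only [Pi.sub_apply, primitive, h3]
      abel
    rw [h2, eLpNorm_sub_comm]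
    exact vpNorm_primitive_zero_le hp (hk.sub (hu n).1)

/-- For `a` in `[0,T]` the operation `⊕_a` on primitives is this splice of densities; for other `a`
the splice equals `k₁` or `k₂` almost everywhere on `(0,T]`. -/
theorem splice_Iio_mem_densities (hT : 0 ≤ T) (hp : 1 ≤ p) {x₀ : EuclideanSpace ℝ (Fin d)}
    {R : Set (Set.Icc (0 : ℝ) T → EuclideanSpace ℝ (Fin d))} (hdec : IsVpDecomposable hT R)
    (a : ℝ) (k₁ : ℝ → EuclideanSpace ℝ (Fin d)) (h₁ : k₁ ∈ densities p x₀ R)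
    (k₂ : ℝ → EuclideanSpace ℝ (Fin d)) (h₂ : k₂ ∈ densities p x₀ R) :
    splice (Set.Iio a) k₁ k₂ ∈ densities p x₀ R := by
  have hint : ∀ {w : ℝ → EuclideanSpace ℝ (Fin d)},
      MemLp w (ENNReal.ofReal p) (volume.restrict (Set.Ioc 0 T)) →
      IntegrableOn w (Set.Ioc 0 T) := fun hw => hw.integrable (by simpa using hp)
  have hcongr : ∀ k ∈ densities p x₀ R, ∀ k', k =ᵐ[volume.restrict (Set.Ioc 0 T)] k' →
      k' ∈ densities p x₀ R := by
    intro k hk k' h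
    refine ⟨hk.1.ae_eq h, ?_⟩
    rw [← primitive_congr h]
    exact hk.2
  rcases lt_or_ge a 0 with ha | ha
  · refine hcongr k₂ h₂ _ ((ae_restrict_iff' measurableSet_Ioc).2 (ae_of_all _ fun s hs => ?_))
    rw [splice_of_notMem]
    exact not_lt.2 (ha.le.trans hs.1.le)
  rcases lt_or_ge T a with haT | haT
  · refine hcongr k₁ h₁ _ ((ae_restrict_iff' measurableSet_Ioc).2 (ae_of_all _ fun s hs => ?_))
    rw [splice_of_mem]
    exact hs.2.trans_lt haT
  refine ⟨h₂.1.add ((h₁.1.sub h₂.1).indicator measurableSet_Iio), ?_⟩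
  have hmem := hdec _ h₁.2 _ h₂.2 a ⟨ha, haT⟩
  convert! hmem using 1
  ext1 t
  have h0 : primitive x₀ k₁ ⟨0, Set.left_mem_Icc.2 hT⟩ = x₀ := by
    simp [primitive]
  rw [oplus, h0, primitive, intervalIntegral.integral_of_le t.2.1,
    intervalIntegral.integral_of_le t.2.1]
  congr 1
  refine integral_congr_ae (ae_restrict_of_ae_restrict_of_subset
    (Set.Ioc_subset_Ioc_right t.2.2) ?_)
  filter_upwards [derivIcc_primitive_ae_eq hT x₀ (hint h₁.1),
    derivIcc_primitive_ae_eq hT x₀ (hint h₂.1), ae_restrict_mem measurableSet_Ioc] with s e1 e2 hs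
  rcases lt_or_ge s a with hsa | hsa
  · rw [splice_of_mem (show s ∈ Set.Iio a from hsa),
      Set.indicator_of_mem (show s ∈ Set.Ico 0 a from ⟨hs.1.le, hsa⟩),
      Set.indicator_of_notMem (fun h : s ∈ Set.Icc a T => not_lt.2 h.1 hsa), e1, add_zero]
  · rw [splice_of_notMem (show s ∉ Set.Iio a from not_lt.2 hsa),
      Set.indicator_of_notMem (fun h : s ∈ Set.Ico 0 a => not_lt.2 hsa h.2),
      Set.indicator_of_mem (show s ∈ Set.Icc a T from ⟨hsa, hs.2⟩), e2, zero_add]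

end Family

end RieszVar

/-! ### Convex bodies of integrals: additivity and differentiation. -/

namespace IsDecomposableFamily

variable {d : ℕ} {μ : Measure ℝ} [IsFiniteMeasure μ] [NullSingletonClass μ] {p : ℝ}
  {K : Set (ℝ → EuclideanSpace ℝ (Fin d))} {g : ℝ → ℝ}

/-- The set of integrals over `A` of the members of a decomposable family. -/
noncomputable def integralBody (hK : IsDecomposableFamily μ p K g) (hp : 1 ≤ p) {A : Set ℝ}
    (hA : MeasurableSet A) : ConvexBody (EuclideanSpace ℝ (Fin d)) where
  carrier := (fun k => ∫ s in A, k s ∂μ) '' K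
  convex' := hK.convex_image_setIntegral hp A
  isCompact' := hK.isCompact_image_setIntegral hp hA
  nonempty' := hK.nonempty.image _

theorem coe_integralBody (hK : IsDecomposableFamily μ p K g) (hp : 1 ≤ p) {A : Set ℝ}
    (hA : MeasurableSet A) :
    (hK.integralBody hp hA : Set (EuclideanSpace ℝ (Fin d))) = (fun k => ∫ s in A, k s ∂μ) '' K :=
  rfl

/-- A sum of integrals of different members is the integral of their splice along `A`. This
additivity is what makes the Hukuhara differences exist. -/
theorem integralBody_eq_add (hK : IsDecomposableFamily μ p K g) (hp : 1 ≤ p) {A B C : Set ℝ}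
    (hA : MeasurableSet A) (hB : MeasurableSet B) (hC : MeasurableSet C) (hd : Disjoint A B)
    (hCeq : A ∪ B = C) :
    hK.integralBody hp hC = hK.integralBody hp hA + hK.integralBody hp hB := by
  subst hCeq
  have hadd : ∀ k ∈ K, ∫ s in A ∪ B, k s ∂μ = ∫ s in A, k s ∂μ + ∫ s in B, k s ∂μ := fun k hk =>
    setIntegral_union hd hB (hK.integrable hp hk).integrableOn (hK.integrable hp hk).integrableOn
  refine ConvexBody.ext ?_
  rw [ConvexBody.coe_add, coe_integralBody, coe_integralBody, coe_integralBody]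
  ext z
  rw [Set.mem_add]
  constructor
  · rintro ⟨k, hk, rfl⟩
    exact ⟨_, ⟨k, hk, rfl⟩, _, ⟨k, hk, rfl⟩, (hadd k hk).symm⟩
  · rintro ⟨_, ⟨k₁, h₁, rfl⟩, _, ⟨k₂, h₂, rfl⟩, rfl⟩
    have hs := hK.splice_mem A hA k₁ h₁ k₂ h₂
    refine ⟨_, hs, ?_⟩
    simp only
    rw [hadd _ hs]
    congr 1
    · exact setIntegral_congr_fun hA fun s hs => splice_of_mem hs
    · exact setIntegral_congr_fun hB fun s hs => splice_of_notMem (Set.disjoint_right.1 hd hs)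

theorem tendsto_smul_integralBody (hK : IsDecomposableFamily μ p K g) (hp : 1 ≤ p)
    {f : ℕ → ℝ → EuclideanSpace ℝ (Fin d)} (hfm : ∀ n, StronglyMeasurable (f n))
    (hfK : ∀ n, f n ∈ K)
    (hdense : ∀ k ∈ K, ∀ᵐ s ∂μ, k s ∈ closure (Set.range fun n => f n s))
    (hfg : ∀ᵐ s ∂μ, ∀ n, ‖f n s‖ ≤ g s) {t : ℝ} (ht : ∀ n, ‖f n t‖ ≤ g t)
    {A : ℝ → Set ℝ} (hA : ∀ h, MeasurableSet (A h)) {Q : Set (EuclideanSpace ℝ (Fin d))}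
    (hQ : Dense Q)
    (hlim : ∀ u ∈ Q, Tendsto
      (fun h => h⁻¹ * ∫ s in A h, supportFn (Set.range fun n => f n s) u ∂μ) (𝓝[>] 0)
      (𝓝 (supportFn (Set.range fun n => f n t) u)))
    (hlimg : Tendsto (fun h => h⁻¹ * ∫ s in A h, g s ∂μ) (𝓝[>] 0) (𝓝 (g t)))
    {D : ConvexBody (EuclideanSpace ℝ (Fin d))}
    (hD : (D : Set (EuclideanSpace ℝ (Fin d))) =
      closedConvexHull ℝ (closure (Set.range fun n => f n t))) :
    Tendsto (fun h => h⁻¹ • hK.integralBody hp (hA h)) (𝓝[>] 0) (𝓝 D) := by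
  have hne : (Set.range fun n => f n t).Nonempty := Set.range_nonempty _
  -- The slack `1` is for the rescaled bodies: they are bounded by averages of `g`, which only
  -- converge to `g t`.
  have hM : ∀ x ∈ Set.range fun n => f n t, ‖x‖ ≤ g t + 1 := by
    rintro _ ⟨n, rfl⟩
    linarith [ht n]
  have hM' : ∀ x ∈ closure (Set.range fun n => f n t), ‖x‖ ≤ g t + 1 := fun x hx =>
    closure_minimal (t := {x | ‖x‖ ≤ g t + 1}) hM (isClosed_le continuous_norm continuous_const) hx
  have hDM : ∀ x ∈ D, ‖x‖ ≤ g t + 1 := by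
    intro x hx
    have hx' : x ∈ closedConvexHull ℝ (closure (Set.range fun n => f n t)) := hD ▸ hx
    exact mem_closedBall_zero_iff.1 (closedConvexHull_min
      (t := Metric.closedBall (0 : EuclideanSpace ℝ (Fin d)) (g t + 1))
      (fun y hy => mem_closedBall_zero_iff.2 (hM' y hy)) (convex_closedBall _ _)
      Metric.isClosed_closedBall hx')
  refine tendsto_convexBody_of_tendsto_supportFn (M := g t + 1) ?_ hDM hQ fun u hu => ?_
  · filter_upwards [hlimg.eventually_le_const (lt_add_one (g t)), self_mem_nhdsWithin] with h hh h0
    have hpos : 0 < h := h0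
    intro x hx
    rw [← SetLike.mem_coe, ConvexBody.coe_smul, coe_integralBody] at hx
    obtain ⟨_, ⟨k, hk, rfl⟩, rfl⟩ := hx
    simp only
    rw [norm_smul, norm_inv, Real.norm_of_nonneg hpos.le]
    refine le_trans ?_ hh
    gcongr
    exact hK.norm_setIntegral_le hp hk _
  · rw [hD, supportFn_closedConvexHull hne.closure hM', supportFn_closure hne hM]
    refine (hlim u hu).congr' ?_
    filter_upwards [self_mem_nhdsWithin] with h h0
    have hpos : 0 < h := h0
    rw [ConvexBody.coe_smul, coe_integralBody, supportFn_smul (inv_nonneg.2 hpos.le),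
      hK.supportFn_image_setIntegral hp hfm hfK hdense hfg]

end IsDecomposableFamily

theorem tendsto_inv_mul_setIntegral_Ioc {T t : ℝ} (ht : t ∈ Set.Ioo 0 T) {φ : ℝ → ℝ}
    (hφ : IntegrableOn φ (Set.Ioc 0 T))
    (hd : HasDerivAt (fun x => ∫ s in (0 : ℝ)..x, φ s) (φ t) t) :
    Tendsto (fun h => h⁻¹ * ∫ s in Set.Ioc t (t + h), φ s ∂(volume.restrict (Set.Ioc 0 T)))
      (𝓝[>] 0) (𝓝 (φ t)) ∧
    Tendsto (fun h => h⁻¹ * ∫ s in Set.Ioc (t - h) t, φ s ∂(volume.restrict (Set.Ioc 0 T)))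
      (𝓝[>] 0) (𝓝 (φ t)) := by
  have hint : ∀ x ∈ Set.Icc 0 T, IntervalIntegrable φ volume 0 x := fun x hx =>
    (intervalIntegrable_iff_integrableOn_Ioc_of_le hx.1).2
      (hφ.mono_set (Set.Ioc_subset_Ioc_right hx.2))
  have hkey : ∀ x y, 0 ≤ x → x ≤ y → y ≤ T →
      ∫ s in Set.Ioc x y, φ s ∂(volume.restrict (Set.Ioc 0 T)) =
        (∫ s in (0 : ℝ)..y, φ s) - ∫ s in (0 : ℝ)..x, φ s := by
    intro x y h0 hxy hT
    rw [Measure.restrict_restrict measurableSet_Ioc,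
      Set.inter_eq_left.2 (Set.Ioc_subset_Ioc h0 hT),
      intervalIntegral.integral_interval_sub_left (hint y ⟨h0.trans hxy, hT⟩)
        (hint x ⟨h0, hxy.trans hT⟩), intervalIntegral.integral_of_le hxy]
  constructor
  · refine hd.tendsto_slope_zero_right.congr' ?_
    filter_upwards [Ioo_mem_nhdsGT (sub_pos.2 ht.2)] with h hh
    rw [hkey t (t + h) ht.1.le (by linarith [hh.1]) (by linarith [hh.2]), smul_eq_mul]
  · have hneg : Tendsto (fun h : ℝ => -h) (𝓝[>] 0) (𝓝[<] 0) := by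
      have := tendsto_neg_nhdsGT (a := (0 : ℝ))
      rwa [neg_zero] at this
    refine (hd.tendsto_slope_zero_left.comp hneg).congr' ?_
    filter_upwards [Ioo_mem_nhdsGT ht.1] with h hh
    rw [hkey (t - h) t (by linarith [hh.2]) (by linarith [hh.1]) ht.2.le, Function.comp_apply,
      smul_eq_mul, ← sub_eq_add_neg, inv_neg]
    ring

/-! ### The set-valued map `Φ` and its measurability. -/

namespace RieszVar

/-- The closure of the set of values of a sequence of functions at the points where these values
are bounded by `g`, and `{0}` elsewhere. -/
noncomputable def closureRange {d : ℕ} (f : ℕ → ℝ → EuclideanSpace ℝ (Fin d)) (g : ℝ → ℝ) (s : ℝ) :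
    TopologicalSpace.NonemptyCompacts (EuclideanSpace ℝ (Fin d)) :=
  open Classical in
  if h : ∀ n, ‖f n s‖ ≤ g s then
    { carrier := closure (Set.range fun n => f n s)
      isCompact' := Metric.isCompact_of_isClosed_isBounded isClosed_closure
        (Bornology.IsBounded.closure (isBounded_iff_forall_norm_le.2
          ⟨g s, by rintro _ ⟨n, rfl⟩; exact h n⟩))
      nonempty' := (Set.range_nonempty _).closure }
  else
    { carrier := {0}
      isCompact' := isCompact_singleton
      nonempty' := Set.singleton_nonempty 0 }

section ClosureRange

variable {d : ℕ} {f : ℕ → ℝ → EuclideanSpace ℝ (Fin d)} {g : ℝ → ℝ}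

theorem coe_closureRange_of_le {s : ℝ} (h : ∀ n, ‖f n s‖ ≤ g s) :
    (closureRange f g s : Set (EuclideanSpace ℝ (Fin d))) = closure (Set.range fun n => f n s) := by
  rw [closureRange, dif_pos h]
  rfl

theorem coe_closureRange_of_not_le {s : ℝ} (h : ¬ ∀ n, ‖f n s‖ ≤ g s) :
    (closureRange f g s : Set (EuclideanSpace ℝ (Fin d))) = {0} := by
  rw [closureRange, dif_neg h]
  rfl

theorem norm_le_of_mem_closureRange {s : ℝ} (h : ∀ n, ‖f n s‖ ≤ g s)
    {x : EuclideanSpace ℝ (Fin d)} (hx : x ∈ closureRange f g s) : ‖x‖ ≤ g s := by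
  rw [← SetLike.mem_coe, coe_closureRange_of_le h] at hx
  refine closure_minimal (t := {x | ‖x‖ ≤ g s}) ?_
    (isClosed_le continuous_norm continuous_const) hx
  rintro _ ⟨n, rfl⟩
  exact h n

theorem isMeasurableSetValued_closureRange (hf : ∀ n, StronglyMeasurable (f n))
    (hg : Measurable g) : IsMeasurableSetValued (closureRange f g) := by
  intro U hU
  have hgood : MeasurableSet {s | ∀ n, ‖f n s‖ ≤ g s} := by
    rw [Set.ofPred_forall]
    exact MeasurableSet.iInter fun n => measurableSet_le (hf n).norm.measurable hg
  have : {s | ((closureRange f g s : Set (EuclideanSpace ℝ (Fin d))) ∩ U).Nonempty} =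
      ({s | ∀ n, ‖f n s‖ ≤ g s} ∩ ⋃ n, f n ⁻¹' U) ∪
        ({s | ∀ n, ‖f n s‖ ≤ g s}ᶜ ∩ {_s | (0 : EuclideanSpace ℝ (Fin d)) ∈ U}) := by
    ext s
    by_cases h : ∀ n, ‖f n s‖ ≤ g s
    · have h1 : s ∈ {s | ∀ n, ‖f n s‖ ≤ g s} := h
      simp only [Set.mem_ofPred_eq, coe_closureRange_of_le h, closure_inter_open_nonempty_iff hU,
        Set.mem_union, Set.mem_inter_iff, Set.mem_compl_iff, h1, not_true_eq_false, false_and,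
        or_false, true_and, Set.mem_iUnion, Set.mem_preimage]
      constructor
      · rintro ⟨_, ⟨n, rfl⟩, hn⟩
        exact ⟨n, hn⟩
      · rintro ⟨n, hn⟩
        exact ⟨_, ⟨n, rfl⟩, hn⟩
    · have h1 : s ∉ {s | ∀ n, ‖f n s‖ ≤ g s} := h
      simp only [Set.mem_ofPred_eq, coe_closureRange_of_not_le h, Set.singleton_inter_nonempty,
        Set.mem_union, Set.mem_inter_iff, Set.mem_compl_iff, h1, not_false_eq_true, false_and,
        false_or, true_and]
  rw [this]
  exact (hgood.inter (MeasurableSet.iUnion fun n => (hf n).measurable hU.measurableSet)).union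
    (hgood.compl.inter (MeasurableSet.const _))

end ClosureRange

end RieszVar

/-! ### The theorem. -/

theorem theorem3 (d : ℕ) (T p : ℝ) (hT : 0 < T) (hp : 1 ≤ p)
    (R : Set (Set.Icc (0 : ℝ) T → EuclideanSpace ℝ (Fin d)))
    (hRBV : R ⊆ RieszVar.BV (EuclideanSpace ℝ (Fin d)) T p)
    (hAC : p = 1 → ∀ f ∈ R, AbsolutelyContinuousOnInterval (Set.IccExtend hT.le f) 0 T)
    (x₀ : EuclideanSpace ℝ (Fin d))
    (hR0 : RieszVar.valuesAt R ⟨0, Set.left_mem_Icc.2 hT.le⟩ = {x₀})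
    (hclosed : RieszVar.IsVpClosed p R)
    (hbdd : RieszVar.IsVpBounded p R)
    (hdec : RieszVar.IsVpDecomposable hT.le R) :
    ∃ Φ : Set.Icc (0 : ℝ) T → TopologicalSpace.NonemptyCompacts (EuclideanSpace ℝ (Fin d)),
      RieszVar.IsMeasurableSetValued Φ ∧ RieszVar.IsIntegrablyBounded p Φ ∧
      ∃ G : ℝ → ConvexBody (EuclideanSpace ℝ (Fin d)),
        (∀ t : Set.Icc (0 : ℝ) T,
          (G t : Set (EuclideanSpace ℝ (Fin d))) = RieszVar.valuesAt R t) ∧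
        ∀ᵐ (t : Set.Icc (0 : ℝ) T) ∂(RieszVar.lebesgue T), ∃ D : ConvexBody (EuclideanSpace ℝ (Fin d)),
          RieszVar.HasHukuharaDerivAt G (t : ℝ) D ∧
          (D : Set (EuclideanSpace ℝ (Fin d)))
            = closedConvexHull ℝ (Φ t : Set (EuclideanSpace ℝ (Fin d))) := by
  have hAC' : ∀ f ∈ R, AbsolutelyContinuousOnInterval (Set.IccExtend hT.le f) 0 T := by
    rcases hp.eq_or_lt with h | h
    · exact hAC h.symm
    · exact fun f hf =>
        RieszVar.absolutelyContinuousOnInterval_of_rieszVariation_lt_top hT.le h (hRBV hf)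
  have hR0' : ∀ f ∈ R, f ⟨0, Set.left_mem_Icc.2 hT.le⟩ = x₀ := by
    intro f hf
    have : f ⟨0, Set.left_mem_Icc.2 hT.le⟩ ∈
        RieszVar.valuesAt R ⟨0, Set.left_mem_Icc.2 hT.le⟩ := ⟨f, hf, rfl⟩
    rwa [hR0] at this
  have hmem := fun f hf => RieszVar.mem_densities_of_mem hT.le hp (R := R) (f := f) hf (hRBV hf)
    (hAC' f hf) (hR0' f hf)
  set K := RieszVar.densities p x₀ R with hKdef
  set μ : Measure ℝ := volume.restrict (Set.Ioc 0 T) with hμ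
  have hKne : K.Nonempty := by
    have : (RieszVar.valuesAt R ⟨0, Set.left_mem_Icc.2 hT.le⟩).Nonempty := by
      rw [hR0]
      exact Set.singleton_nonempty _
    obtain ⟨_, f, hf, -⟩ := this
    exact ⟨_, (hmem f hf).1⟩
  obtain ⟨C, hCtop, hC⟩ := hbdd
  have hLp : ∀ k ∈ K, MemLp k (ENNReal.ofReal p) μ := fun k hk => hk.1
  have hKcl := RieszVar.mem_densities_of_tendsto hp (x₀ := x₀) hclosed
  obtain ⟨f, g, hK, hfm, hfK, hdense, hgm, hfg⟩ := exists_isDecomposableFamily hp hKne hLp hKcl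
    (splice_mem_of_forall_Iio hp hLp hKcl (RieszVar.splice_Iio_mem_densities hT.le hp hdec))
    hCtop.ne (fun k hk => RieszVar.eLpNorm_le_of_mem_densities hT.le hp hAC' hRBV hC hk)
  have hIcc : μ = volume.restrict (Set.Icc 0 T) := Measure.restrict_congr_set Ioc_ae_eq_Icc
  have hmap : (RieszVar.lebesgue T).map Subtype.val = volume.restrict (Set.Icc 0 T) :=
    map_comap_subtype_coe measurableSet_Icc _
  have hae : ∀ {P : ℝ → Prop}, (∀ᵐ s ∂μ, P s) →
      ∀ᵐ t : Set.Icc (0 : ℝ) T ∂(RieszVar.lebesgue T), P t := by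
    intro P hP
    rw [hIcc, ← hmap] at hP
    exact ae_of_ae_map measurable_subtype_coe.aemeasurable hP
  refine ⟨fun t => RieszVar.closureRange f g t, ?_, ⟨fun t => g t, ?_, ?_⟩, ?_⟩
  · intro U hU
    exact measurable_subtype_coe (RieszVar.isMeasurableSetValued_closureRange hfm hgm U hU)
  · have h := hK.memLp_bound
    rw [hIcc, ← hmap] at h
    exact h.comp_of_map measurable_subtype_coe.aemeasurable
  · exact hae (P := fun s => ∀ x ∈ RieszVar.closureRange f g s, ‖x‖ ≤ g s) (hfg.mono fun s hs x hx =>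
      RieszVar.norm_le_of_mem_closureRange hs hx)
  let B : ℝ → ℝ → ConvexBody (EuclideanSpace ℝ (Fin d)) := fun a b =>
    hK.integralBody hp (measurableSet_Ioc (a := a) (b := b))
  let X : ConvexBody (EuclideanSpace ℝ (Fin d)) :=
    ⟨{x₀}, convex_singleton x₀, isCompact_singleton, Set.singleton_nonempty x₀⟩
  have hBadd : ∀ a b c, a ≤ b → b ≤ c → B a c = B a b + B b c := by
    intro a b c hab hbc
    exact hK.integralBody_eq_add hp _ _ _ (Set.Ioc_disjoint_Ioc_of_le le_rfl)
      (Set.Ioc_union_Ioc_eq_Ioc hab hbc)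
  refine ⟨fun t => X + B 0 t, fun t => ?_, ?_⟩
  · have hkey : ∀ k : ℝ → EuclideanSpace ℝ (Fin d),
        x₀ + ∫ s in Set.Ioc 0 (t : ℝ), k s ∂μ = RieszVar.primitive x₀ k t := by
      intro k
      rw [RieszVar.primitive, intervalIntegral.integral_of_le t.2.1, hμ,
        Measure.restrict_restrict measurableSet_Ioc,
        Set.inter_eq_left.2 (Set.Ioc_subset_Ioc_right t.2.2)]
    rw [ConvexBody.coe_add]
    change ({x₀} : Set (EuclideanSpace ℝ (Fin d))) +
      (fun k => ∫ s in Set.Ioc 0 (t : ℝ), k s ∂μ) '' K = _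
    rw [Set.singleton_add, Set.image_image]
    simp only [hkey]
    refine subset_antisymm ?_ ?_
    · rintro _ ⟨k, hk, rfl⟩
      exact ⟨_, hk.2, rfl⟩
    · rintro _ ⟨φ, hφ, rfl⟩
      exact ⟨_, (hmem φ hφ).1, by simp only [(hmem φ hφ).2]⟩
  -- Lebesgue differentiation has an exceptional null set for each direction, so only countably many
  -- directions can be used.
  · obtain ⟨Q, hQc, hQd⟩ := TopologicalSpace.exists_countable_dense (EuclideanSpace ℝ (Fin d))
    have hderiv : ∀ {φ : ℝ → ℝ}, Integrable φ μ →
        ∀ᵐ t ∂μ, HasDerivAt (fun x => ∫ s in (0 : ℝ)..x, φ s) (φ t) t := by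
      intro φ hφ
      have hi : IntervalIntegrable φ volume 0 T :=
        (intervalIntegrable_iff_integrableOn_Ioc_of_le hT.le).2 hφ
      refine (ae_restrict_iff' measurableSet_Ioc).2 ?_
      filter_upwards [hi.ae_hasDerivAt_integral] with x hx hxT
      exact hx (by rw [Set.uIcc_of_le hT.le]; exact Set.Ioc_subset_Icc_self hxT) 0 Set.left_mem_uIcc
    have hσ := fun u => hK.integrable_supportFn_range hp hfm hfg u
    have hIoo : ∀ᵐ t ∂μ, t ∈ Set.Ioo 0 T := by
      rw [hμ, ← restrict_Ioo_eq_restrict_Ioc]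
      exact ae_restrict_mem measurableSet_Ioo
    refine hae (P := fun t => ∃ D : ConvexBody (EuclideanSpace ℝ (Fin d)),
      RieszVar.HasHukuharaDerivAt (fun t => X + B 0 t) t D ∧
      (D : Set (EuclideanSpace ℝ (Fin d))) =
        closedConvexHull ℝ (RieszVar.closureRange f g t : Set (EuclideanSpace ℝ (Fin d)))) ?_
    filter_upwards [hIoo, hfg, hderiv (hK.integrable_bound hp),
      (ae_ball_iff hQc).2 fun u _ => hderiv (hσ u)] with t htT ht hgt hσt
    have hbd : ∀ x ∈ closedConvexHull ℝ (RieszVar.closureRange f g t : Set (EuclideanSpace ℝ (Fin d))), ‖x‖ ≤ g t := by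
      intro x hx
      exact mem_closedBall_zero_iff.1 (closedConvexHull_min
        (t := Metric.closedBall (0 : EuclideanSpace ℝ (Fin d)) (g t))
        (fun y hy => mem_closedBall_zero_iff.2 (RieszVar.norm_le_of_mem_closureRange ht hy))
        (convex_closedBall _ _) Metric.isClosed_closedBall hx)
    let D : ConvexBody (EuclideanSpace ℝ (Fin d)) :=
      { carrier := closedConvexHull ℝ (RieszVar.closureRange f g t : Set (EuclideanSpace ℝ (Fin d)))
        convex' := convex_closedConvexHull
        isCompact' := Metric.isCompact_of_isClosed_isBounded isClosed_closedConvexHull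
          (isBounded_iff_forall_norm_le.2 ⟨g t, hbd⟩)
        nonempty' := (RieszVar.closureRange f g t).nonempty.mono subset_closedConvexHull }
    have hD : (D : Set (EuclideanSpace ℝ (Fin d))) =
        closedConvexHull ℝ (closure (Set.range fun n => f n t)) := by
      rw [← RieszVar.coe_closureRange_of_le ht]
      rfl
    have hg2 := tendsto_inv_mul_setIntegral_Ioc htT (hK.integrable_bound hp) hgt
    have hσ2 := fun u (hu : u ∈ Q) => tendsto_inv_mul_setIntegral_Ioc htT (hσ u) (hσt u hu)
    -- By additivity the differences are the integral bodies over `(t, t + h]` and `(t - h, t]`. As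
    -- `μ` lives on `(0,T]`, the first identity holds for every `h > 0`; the second is used for `h <
    -- t`.
    refine ⟨D, ⟨⟨fun h => B t (t + h), ?_, ?_⟩, ⟨fun h => B (t - h) t, ?_, ?_⟩⟩, rfl⟩
    · filter_upwards [self_mem_nhdsWithin] with h hh
      have hpos : 0 < h := hh
      rw [RieszVar.IsHukuharaDifference, hBadd 0 t (t + h) htT.1.le (by linarith), add_assoc]
    · exact hK.tendsto_smul_integralBody hp hfm hfK hdense hfg ht (fun _ => measurableSet_Ioc) hQd
        (fun u hu => (hσ2 u hu).1) hg2.1 hD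
    · filter_upwards [Ioo_mem_nhdsGT htT.1] with h hh
      rw [RieszVar.IsHukuharaDifference, hBadd 0 (t - h) t (by linarith [hh.2])
        (by linarith [hh.1]), add_assoc]
    · exact hK.tendsto_smul_integralBody hp hfm hfK hdense hfg ht (fun _ => measurableSet_Ioc) hQd
        (fun u hu => (hσ2 u hu).2) hg2.2 hD
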